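/- Setting. Let $K, L \ge 1$ and $n \ge 2$ be integers, let $P_U$ and $P_V$ be probability distributions on $[0,1]^K$ and $[0,1]^L$, let $u_1, u_2, \dots$ be i.i.d. with law $P_U$ and $v_1, v_2, \dots$ i.i.d. with law $P_V$, the two sequences being independent of each other (the entries of one vector may be dependent). At time $t$ an agent chooses an arm $(i_t, j_t) \in [K] \times [L]$ on the basis of its past observations (and its own randomization), and observes only the reward $u_t(i_t) v_t(j_t)$. Let $\bar u = E[u_1]$, $\bar v = E[v_1]$, let $(i^*, j^*)$ be any maximizer of $E[u_1(i) v_1(j)]$, and let $$R(n) = E\Big[\sum_{t=1}^n \big(u_t(i^*) v_t(j^*) - u_t(i_t) v_t(j_t)\big)\Big].$$ Algorithm (Rank1Elim with horizon $n$). Start with $t = 1$, $K \times L$ matrices $C^u = C^v = 0$, and the identity maps $h^u$ on $[K]$ and $h^v$ on $[L]$. Put $n_{-1} = 0$ and $n_\ell = \lceil 4 \tilde\Delta_\ell^{-2} \log n \rceil$ with $\tilde\Delta_\ell = 2^{-\ell}$. In stage $\ell = 0, 1, 2, \dots$ let $I = h^u([K])$ and $J = h^v([L])$ (the remaining rows and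 columns), and do the following. 1. Exploration. Repeat $n_\ell - n_{\ell-1}$ times: draw $c \in [L]$ uniformly at random, put $j = h^v(c)$, and for all $i \in I$ choose arm $(i,j)$, add its reward $u_t(i) v_t(j)$ to $C^u(i,j)$ and increase $t$ by one; then draw $r \in [K]$ uniformly at random, put $i = h^u(r)$, and for all $j \in J$ choose arm $(i,j)$, add its reward $u_t(i) v_t(j)$ to $C^v(i,j)$ and increase $t$ by one. All random draws are independent of each other and of the vectors $u_t, v_t$. 2. Elimination. With $\rho = \sqrt{\log n / n_\ell}$, let $U^u(i), L^u(i) = \frac{1}{n_\ell} \sum_{j=1}^L C^u(i,j) \pm \rho$ for $i \in I$ and $U^v(j), L^v(j) = \frac{1}{n_\ell} \sum_{i=1}^K C^v(i,j) \pm \rho$ for $j \in J$. Let $i_\ell \in \arg\max_{i \in I} L^u(i)$ and $j_\ell \in \arg\max_{j \in J} L^v(j)$. For every $i \in [K]$ with $U^u(h^u(i)) \le L^u(i_\ell)$ set $h^u(i)$ to $i_\ell$, and for every $j \in [L]$ with $U^v(h^v(j)) \le L^v(j_\ell)$ set $h^v(j)$ to $j_\ell$. The matrices $C^u, C^v$ are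 carried over from stage to stage. Ties in the $\arg\max$ may be broken by any fixed measurable rule, and the loops over $I$ and $J$ may visit these sets in any order that is a fixed function of the set. Theorem 1. Let $\Delta^u_i = \bar u(i^*) - \bar u(i)$ and $\Delta^v_j = \bar v(j^*) - \bar v(j)$, let $\Delta^u_{\min} = \min\{\Delta^u_i : \Delta^u_i > 0\}$ and $\Delta^v_{\min} = \min\{\Delta^v_j : \Delta^v_j > 0\}$ (with $\min \emptyset = \infty$), let $$\bar\Delta^u_i = \Delta^u_i + \mathbf 1\{\Delta^u_i = 0\}\, \Delta^v_{\min}, \qquad \bar\Delta^v_j = \Delta^v_j + \mathbf 1\{\Delta^v_j = 0\}\, \Delta^u_{\min},$$ and let $\mu = \min\{\frac1K \sum_{i=1}^K \bar u(i), \frac1L \sum_{j=1}^L \bar v(j)\}$. Then the $n$-step regret of Rank1Elim is integrable, and its expectation satisfies $$R(n) \le \frac{1}{\mu^2} \Big(\sum_{i=1}^K \frac{384}{\bar\Delta^u_i} + \sum_{j=1}^L \frac{384}{\bar\Delta^v_j}\Big) \log n + 3 (K + L),$$ where $384/\infty = 0$. (If $\mu = 0$, then $R(n) = 0$, and the right-hand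 side is read as $3(K+L)$ if the sum in parentheses is zero and as $\infty$ otherwise.) -/

import Mathlib

open MeasureTheory
open scoped ENNReal

noncomputable section

namespace Rank1

/-! ### The algorithm -/

/-- The two choices that the description of the algorithm leaves open for a finite index set `ι`
(the rows or the columns): the order in which a loop "for all `i ∈ s`" visits the elements of `s`,
and the maximizer returned by `argmax_{i ∈ s} f i` when there are ties. -/
structure Convention (ι : Type) where
  /-- the elements of `s`, each of them once, in the order in which they are visited -/
  order : Finset ι → List ι
  nodup_order : ∀ s, (order s).Nodup
  mem_order : ∀ s i, i ∈ order s ↔ i ∈ s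
  /-- a maximizer of `f` over `s` -/
  pick : Finset ι → (ι → ℝ) → ι
  pick_mem : ∀ (s : Finset ι) (f : ι → ℝ), s.Nonempty → pick s f ∈ s
  le_pick : ∀ (s : Finset ι) (f : ι → ℝ) (i : ι), i ∈ s → f i ≤ f (pick s f)
  measurable_pick : ∀ (s : Finset ι) (i : ι), MeasurableSet {f : ι → ℝ | pick s f = i}

/-- The variables of the algorithm. The arms chosen so far are kept in chronological order in
`log`, so with times counted from `0` the current time is `log.length`. -/
structure State (K L : ℕ) where
  log : List (Fin K × Fin L)
  Cu : Fin K → Fin L → ℝ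
  Cv : Fin K → Fin L → ℝ
  hu : Fin K → Fin K
  hv : Fin L → Fin L

variable {K L : ℕ}

/-- Initialization: time `0`, zero reward matrices, identity maps. -/
def State.init (K L : ℕ) : State K L where
  log := []
  Cu := fun _ _ => 0
  Cv := fun _ _ => 0
  hu := id
  hv := id

/-- The remaining rows. -/
def State.I (s : State K L) : Finset (Fin K) := Finset.univ.image s.hu

/-- The remaining columns. -/
def State.J (s : State K L) : Finset (Fin L) := Finset.univ.image s.hv

/-- Choose arm `(i, j)` at the current time `t`, observe `X t i j` and add it to `Cu i j`. -/
def State.pullU (X : ℕ → Fin K → Fin L → ℝ) (s : State K L) (i : Fin K) (j : Fin L) :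
    State K L :=
  { s with
    log := s.log ++ [(i, j)]
    Cu := fun a b => s.Cu a b + if a = i ∧ b = j then X s.log.length i j else 0 }

/-- Choose arm `(i, j)` at the current time `t`, observe `X t i j` and add it to `Cv i j`. -/
def State.pullV (X : ℕ → Fin K → Fin L → ℝ) (s : State K L) (i : Fin K) (j : Fin L) :
    State K L :=
  { s with
    log := s.log ++ [(i, j)]
    Cv := fun a b => s.Cv a b + if a = i ∧ b = j then X s.log.length i j else 0 }

/-- The body of the exploration loop, for the random column `c` and the random row `r`: all
remaining rows are played in column `hv c`, then all remaining columns in row `hu r`. -/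
def State.explore (cU : Convention (Fin K)) (cV : Convention (Fin L))
    (X : ℕ → Fin K → Fin L → ℝ) (c : Fin L) (r : Fin K) (s : State K L) : State K L :=
  let s₁ := (cU.order s.I).foldl (fun s' i => s'.pullU X i (s.hv c)) s
  (cV.order s.J).foldl (fun s' j => s'.pullV X (s.hu r) j) s₁

/-- `Δ̃_ℓ`, which starts at `1` and is halved after every stage. -/
def gapTilde (ℓ : ℕ) : ℝ := (1 / 2) ^ ℓ

/-- `n_ℓ = ⌈4 Δ̃_ℓ⁻² log n⌉`. -/
def iters (n ℓ : ℕ) : ℕ := ⌈4 * (gapTilde ℓ ^ 2)⁻¹ * Real.log n⌉₊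

/-- `n_{ℓ-1}`, where `n_{-1} = 0`. -/
def prevIters (n : ℕ) : ℕ → ℕ
  | 0 => 0
  | ℓ + 1 => iters n ℓ

/-- The confidence radius `√(log n / n_ℓ)`. -/
def radius (n ℓ : ℕ) : ℝ := √(Real.log n / iters n ℓ)

/-- The upper confidence bound of row `i` at the end of stage `ℓ`. -/
def State.ucbU (n ℓ : ℕ) (s : State K L) (i : Fin K) : ℝ :=
  1 / (iters n ℓ : ℝ) * ∑ j, s.Cu i j + radius n ℓ

/-- The lower confidence bound of row `i` at the end of stage `ℓ`. -/
def State.lcbU (n ℓ : ℕ) (s : State K L) (i : Fin K) : ℝ :=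
  1 / (iters n ℓ : ℝ) * ∑ j, s.Cu i j - radius n ℓ

/-- The upper confidence bound of column `j` at the end of stage `ℓ`. -/
def State.ucbV (n ℓ : ℕ) (s : State K L) (j : Fin L) : ℝ :=
  1 / (iters n ℓ : ℝ) * ∑ i, s.Cv i j + radius n ℓ

/-- The lower confidence bound of column `j` at the end of stage `ℓ`. -/
def State.lcbV (n ℓ : ℕ) (s : State K L) (j : Fin L) : ℝ :=
  1 / (iters n ℓ : ℝ) * ∑ i, s.Cv i j - radius n ℓ

/-- Row and column elimination at the end of stage `ℓ`. -/
def State.eliminate (cU : Convention (Fin K)) (cV : Convention (Fin L)) (n ℓ : ℕ)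
    (s : State K L) : State K L :=
  let iℓ := cU.pick s.I (s.lcbU n ℓ)
  let jℓ := cV.pick s.J (s.lcbV n ℓ)
  { s with
    hu := fun i => if s.ucbU n ℓ (s.hu i) ≤ s.lcbU n ℓ iℓ then iℓ else s.hu i
    hv := fun j => if s.ucbV n ℓ (s.hv j) ≤ s.lcbV n ℓ jℓ then jℓ else s.hv j }

/-- Stage `ℓ`: the exploration loop is run `n_ℓ - n_{ℓ-1}` times, followed by elimination. The
iterations are numbered consecutively through all stages; the `k`-th of them uses the random
column `col k` and the random row `row k`. -/
def State.stage (cU : Convention (Fin K)) (cV : Convention (Fin L)) (n : ℕ)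
    (X : ℕ → Fin K → Fin L → ℝ) (col : ℕ → Fin L) (row : ℕ → Fin K) (ℓ : ℕ) (s : State K L) :
    State K L :=
  ((List.Ico (prevIters n ℓ) (iters n ℓ)).foldl
    (fun s' k => s'.explore cU cV X (col k) (row k)) s).eliminate cU cV n ℓ

/-- The variables after the stages `0, …, m - 1`. -/
def run (cU : Convention (Fin K)) (cV : Convention (Fin L)) (n : ℕ)
    (X : ℕ → Fin K → Fin L → ℝ) (col : ℕ → Fin L) (row : ℕ → Fin K) : ℕ → State K L
  | 0 => State.init K L
  | ℓ + 1 => (run cU cV n X col row ℓ).stage cU cV n X col row ℓ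

/-- The arm chosen at time `t < n`. For `n ≥ 2` the stages `0, …, n - 1` choose at least `n` arms
(`le_length_log`), so that the default value is not used. -/
def arm [NeZero K] [NeZero L] (cU : Convention (Fin K)) (cV : Convention (Fin L)) (n : ℕ)
    (X : ℕ → Fin K → Fin L → ℝ) (col : ℕ → Fin L) (row : ℕ → Fin K) (t : ℕ) : Fin K × Fin L :=
  (run cU cV n X col row n).log.getD t (0, 0)

/-! ### The bandit and the regret -/

/-- The sample space: the row vectors `u_t`, the column vectors `v_t`, the random columns and the
random rows drawn by the algorithm. -/
abbrev Sample (K L : ℕ) : Type :=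
  (ℕ → Fin K → unitInterval) × (ℕ → Fin L → unitInterval) × (ℕ → Fin L) × (ℕ → Fin K)

/-- The uniform distribution on `{0, …, m - 1}`. -/
def uniform (m : ℕ) [NeZero m] : Measure (Fin m) := (PMF.uniformOfFintype (Fin m)).toMeasure

instance (m : ℕ) [NeZero m] : IsProbabilityMeasure (uniform m) := by
  unfold uniform; infer_instance

/-- All draws are independent, `u_t ∼ PU`, `v_t ∼ PV`, and the random columns and rows of the
algorithm are uniform. -/
def law [NeZero K] [NeZero L] (PU : Measure (Fin K → unitInterval)) [IsProbabilityMeasure PU]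
    (PV : Measure (Fin L → unitInterval)) [IsProbabilityMeasure PV] : Measure (Sample K L) :=
  (Measure.infinitePi fun _ : ℕ => PU).prod <| (Measure.infinitePi fun _ : ℕ => PV).prod <|
    (Measure.infinitePi fun _ : ℕ => uniform L).prod (Measure.infinitePi fun _ : ℕ => uniform K)

/-- The reward `u_t(i) v_t(j)` of arm `(i, j)` at time `t`. -/
def reward (ω : Sample K L) (t : ℕ) (i : Fin K) (j : Fin L) : ℝ :=
  (ω.1 t i : ℝ) * (ω.2.1 t j : ℝ)

/-- The stochastic regret of the algorithm, summed over the times `0, …, n - 1`, against the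
fixed arm `(iStar, jStar)`. -/
def cumRegret [NeZero K] [NeZero L] (cU : Convention (Fin K)) (cV : Convention (Fin L)) (n : ℕ)
    (iStar : Fin K) (jStar : Fin L) (ω : Sample K L) : ℝ :=
  ∑ t ∈ Finset.range n,
    let a := arm cU cV n (reward ω) ω.2.2.1 ω.2.2.2 t
    (reward ω t iStar jStar - reward ω t a.1 a.2)

/-- `E[u(i) v(j)]` for independent `u ∼ PU` and `v ∼ PV`. -/
def meanReward (PU : Measure (Fin K → unitInterval)) (PV : Measure (Fin L → unitInterval))
    (i : Fin K) (j : Fin L) : ℝ :=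
  ∫ p, (p.1 i : ℝ) * (p.2 j : ℝ) ∂(PU.prod PV)

/-! ### The quantities in the bound -/

/-- The mean vector of a distribution on the cube `[0,1]^m`. -/
def mean {m : ℕ} (P : Measure (Fin m → unitInterval)) (i : Fin m) : ℝ := ∫ x, (x i : ℝ) ∂P

/-- The gap of `i`, relative to the optimal index `iStar`. -/
def gap {m : ℕ} (P : Measure (Fin m → unitInterval)) (iStar i : Fin m) : ℝ :=
  mean P iStar - mean P i

/-- The minimum positive gap; it is `∞` if no gap is positive. -/
def minGap {m : ℕ} (P : Measure (Fin m → unitInterval)) (iStar : Fin m) : ℝ≥0∞ :=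
  ⨅ (i : Fin m) (_ : 0 < gap P iStar i), ENNReal.ofReal (gap P iStar i)

/-- The gap of `i`, to which `other` is added if the gap is zero. -/
def modGap {m : ℕ} (P : Measure (Fin m → unitInterval)) (iStar : Fin m) (other : ℝ≥0∞)
    (i : Fin m) : ℝ≥0∞ :=
  ENNReal.ofReal (gap P iStar i) + if gap P iStar i = 0 then other else 0

/-- The smaller one of the averages of the entries of the two mean vectors. -/
def avgReward (PU : Measure (Fin K → unitInterval)) (PV : Measure (Fin L → unitInterval)) : ℝ :=
  min (1 / (K : ℝ) * ∑ i, mean PU i) (1 / (L : ℝ) * ∑ j, mean PV j)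

/-! ### The first `n` arms are well defined -/

theorem iters_lt_succ {n : ℕ} (hn : 2 ≤ n) (ℓ : ℕ) : prevIters n ℓ < iters n ℓ := by
  have h2 : (1 / 2 : ℝ) < Real.log n := by
    have h1 := Real.log_two_gt_d9
    have h3 : Real.log 2 ≤ Real.log n := Real.log_le_log (by norm_num) (by exact_mod_cast hn)
    linarith
  have key : ∀ k : ℕ, iters n k = ⌈4 * 4 ^ k * Real.log n⌉₊ := by
    intro k
    have : (gapTilde k ^ 2)⁻¹ = 4 ^ k := by
      rw [gapTilde, ← pow_mul, mul_comm, pow_mul, ← inv_pow]; norm_num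
    rw [iters, this]
  cases ℓ with
  | zero =>
    rw [key]
    exact Nat.ceil_pos.2 (by positivity)
  | succ k =>
    have h4 : (1 : ℝ) ≤ 4 ^ k := one_le_pow₀ (by norm_num)
    have h5 : 4 * 4 ^ k * Real.log n + 1 ≤ 4 * 4 ^ (k + 1) * Real.log n := by
      rw [pow_succ]; nlinarith
    change iters n k < iters n (k + 1)
    rw [key, key, ← Nat.add_one_le_iff, ← Nat.ceil_add_one (by positivity)]
    exact Nat.ceil_le_ceil h5

theorem length_log_explore [NeZero K] (cU : Convention (Fin K)) (cV : Convention (Fin L))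
    (X : ℕ → Fin K → Fin L → ℝ) (c : Fin L) (r : Fin K) (s : State K L) :
    s.log.length + 1 ≤ (s.explore cU cV X c r).log.length := by
  have hU : ∀ (l : List (Fin K)) (j : Fin L) (s : State K L),
      (l.foldl (fun s' i => s'.pullU X i j) s).log.length = s.log.length + l.length := by
    intro l j
    induction l with
    | nil => intro s; rfl
    | cons i l ih =>
      intro s
      rw [List.foldl_cons, ih]
      simp only [State.pullU, List.length_append, List.length_cons, List.length_nil]
      omega
  have hV : ∀ (l : List (Fin L)) (i : Fin K) (s : State K L),
      (l.foldl (fun s' j => s'.pullV X i j) s).log.length = s.log.length + l.length := by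
    intro l i
    induction l with
    | nil => intro s; rfl
    | cons j l ih =>
      intro s
      rw [List.foldl_cons, ih]
      simp only [State.pullV, List.length_append, List.length_cons, List.length_nil]
      omega
  have hpos : 0 < (cU.order s.I).length :=
    List.length_pos_of_mem ((cU.mem_order _ (s.hu 0)).2
      (Finset.mem_image_of_mem _ (Finset.mem_univ _)))
  simp only [State.explore, hU, hV]
  omega

theorem le_length_log [NeZero K] (cU : Convention (Fin K)) (cV : Convention (Fin L)) {n : ℕ}
    (hn : 2 ≤ n) (X : ℕ → Fin K → Fin L → ℝ) (col : ℕ → Fin L) (row : ℕ → Fin K) (m : ℕ) :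
    m ≤ (run cU cV n X col row m).log.length := by
  have hf : ∀ (l : List ℕ) (s : State K L), s.log.length + l.length ≤
      (l.foldl (fun s' k => s'.explore cU cV X (col k) (row k)) s).log.length := by
    intro l
    induction l with
    | nil => intro s; exact le_rfl
    | cons k l ih =>
      intro s
      have h1 := ih (s.explore cU cV X (col k) (row k))
      have h2 := length_log_explore cU cV X (col k) (row k) s
      rw [List.foldl_cons, List.length_cons]
      omega
  induction m with
  | zero => exact Nat.zero_le _
  | succ m ih =>
    have h1 := hf (List.Ico (prevIters n m) (iters n m)) (run cU cV n X col row m)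
    have h2 := iters_lt_succ hn m
    rw [List.Ico.length] at h1
    simp only [run, State.stage, State.eliminate]
    omega

/-- Conventions exist: increasing order, and the smallest maximizer. -/
instance (m : ℕ) [NeZero m] : Nonempty (Convention (Fin m)) := by
  classical
  have hex : ∀ (s : Finset (Fin m)) (f : Fin m → ℝ), s.Nonempty →
      (s.filter fun i => ∀ k ∈ s, f k ≤ f i).Nonempty := by
    intro s f hs
    obtain ⟨i, hi, hmax⟩ := s.exists_max_image f hs
    exact ⟨i, Finset.mem_filter.2 ⟨hi, hmax⟩⟩
  let p : Finset (Fin m) → (Fin m → ℝ) → Fin m := fun s f =>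
    if h : s.Nonempty then (s.filter fun i => ∀ k ∈ s, f k ≤ f i).min' (hex s f h) else 0
  have hp : ∀ s f, s.Nonempty → p s f ∈ s.filter fun i => ∀ k ∈ s, f k ≤ f i := by
    intro s f h
    simp only [p, dif_pos h]
    exact Finset.min'_mem _ _
  refine ⟨⟨fun s => s.sort (· ≤ ·), fun s => Finset.sort_nodup _ _,
    fun s i => Finset.mem_sort _, p,
    fun s f h => (Finset.mem_filter.1 (hp s f h)).1,
    fun s f i hi => (Finset.mem_filter.1 (hp s f ⟨i, hi⟩)).2 i hi, fun s i => ?_⟩⟩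
  by_cases h : s.Nonempty
  · have hset : {f : Fin m → ℝ | p s f = i} =
        {f | (i ∈ s ∧ ∀ k ∈ s, f k ≤ f i) ∧ ∀ a : Fin m, (a ∈ s ∧ ∀ k ∈ s, f k ≤ f a) → i ≤ a} := by
      ext f
      simp only [Set.mem_ofPred_eq, p, dif_pos h]
      constructor
      · rintro rfl
        exact ⟨Finset.mem_filter.1 (Finset.min'_mem _ (hex s f h)),
          fun a ha => Finset.min'_le _ _ (Finset.mem_filter.2 ha)⟩
      · rintro ⟨h1, h2⟩
        exact le_antisymm (Finset.min'_le _ _ (Finset.mem_filter.2 h1))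
          (h2 _ (Finset.mem_filter.1 (Finset.min'_mem _ (hex s f h))))
    rw [hset]
    measurability
  · simp only [p, dif_neg h]
    exact MeasurableSet.const _

end Rank1

end

set_option linter.unusedSectionVars false

noncomputable section

namespace Rank1

open ProbabilityTheory

variable {K L : ℕ}

/-! ### The effect of one exploration -/

/-! The rank-one structure makes the averages comparable. A remaining row `i` is played in column
`hv c` with `c` uniform, so the conditional mean of its reward is `mean PU i * avgMean PV hv`: the
factor beside `mean PU i` is the same for all rows. Over the explorations so far the factors average
to a weight `w`, and the rows are in effect compared through `w * mean PU i`. As long as every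
column is represented by one at least as good, `w ≥ μ`; symmetrically for columns.

Concentration. Each row sum minus its conditional means is a martingale, indexed by explorations,
with increments in an interval of length one. The number of plays before an exploration is random,
so conditioning is expressed by resampling: everything after the stopping time `timeAt k` is
replaced by an independent copy (`measurePreserving_spliceSample_stopping`). Azuma-Hoeffding gives
deviation probability at most `2 / n ^ 2` per index and stage. Over `n` stages and `K + L` indices
the event `Good` fails with probability at most `2 (K + L) / n`, which costs at most `2 (K + L)` in
regret.

On `Good`, `elimination_step` shows that the best row and column survive, that representatives only
improve, and that the rows and columns left in stage `ℓ` satisfy `μ * gap < 4 * gapTilde ℓ`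
(`gap_lt_of_mem_stage`). The expected regret of an arm is at most the sum of its two gaps, hence at
most `8 * gapTilde ℓ / μ`. Row plays are charged to the row, column plays to the column. A row of
gap zero pays only if the column beside it is suboptimal, and then `minGap` of the columns is itself
below `4 * gapTilde ℓ / μ`; this is why `modGap` appears. With at most `6 * 4 ^ ℓ * log n`
explorations in stage `ℓ`, an index of modified gap `d` pays `48 * 2 ^ ℓ * log n / μ` in each stage
with `2 ^ ℓ < 4 / (μ * d)`, a geometric sum bounded by `384 * log n / (μ ^ 2 * d)`. -/

theorem foldl_pullU (X : ℕ → Fin K → Fin L → ℝ) (j : Fin L) (l : List (Fin K)) (hl : l.Nodup)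
    (s : State K L) :
    l.foldl (fun s' i => s'.pullU X i j) s =
      { s with
        log := s.log ++ l.map fun i => (i, j)
        Cu := fun a b => s.Cu a b +
          if a ∈ l ∧ b = j then X (s.log.length + l.idxOf a) a j else 0 } := by
  induction l generalizing s with
  | nil => simp
  | cons i l ih =>
    rw [List.nodup_cons] at hl
    rw [List.foldl_cons, ih hl.2]
    simp only [State.pullU, List.length_append, List.length_cons, List.length_nil, State.mk.injEq,
      List.map_cons, List.append_assoc, List.cons_append, List.nil_append, and_true, true_and]
    funext a b
    by_cases hb : b = j
    · by_cases ha : a = i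
      · subst ha; simp [hb, hl.1]
      · have : i ≠ a := fun h => ha h.symm
        simp [hb, ha, List.idxOf_cons_ne _ this, add_comm, add_left_comm]
    · simp [hb]

theorem foldl_pullV (X : ℕ → Fin K → Fin L → ℝ) (i : Fin K) (l : List (Fin L)) (hl : l.Nodup)
    (s : State K L) :
    l.foldl (fun s' j => s'.pullV X i j) s =
      { s with
        log := s.log ++ l.map fun j => (i, j)
        Cv := fun a b => s.Cv a b +
          if a = i ∧ b ∈ l then X (s.log.length + l.idxOf b) i b else 0 } := by
  induction l generalizing s with
  | nil => simp
  | cons j l ih =>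
    rw [List.nodup_cons] at hl
    rw [List.foldl_cons, ih hl.2]
    simp only [State.pullV, List.length_append, List.length_cons, List.length_nil, State.mk.injEq,
      List.map_cons, List.append_assoc, List.cons_append, List.nil_append, and_true, true_and]
    funext a b
    by_cases ha : a = i
    · by_cases hb : b = j
      · subst hb; simp [ha, hl.1]
      · have : j ≠ b := fun h => hb h.symm
        simp [ha, hb, List.idxOf_cons_ne _ this, add_comm, add_left_comm]
    · simp [ha]

section Explore

variable (cU : Convention (Fin K)) (cV : Convention (Fin L)) (X : ℕ → Fin K → Fin L → ℝ)
  (c : Fin L) (r : Fin K) (s : State K L)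

theorem explore_eq :
    s.explore cU cV X c r =
      { s with
        log := s.log ++ (cU.order s.I).map (fun i => (i, s.hv c)) ++
          (cV.order s.J).map fun j => (s.hu r, j)
        Cu := fun a b => s.Cu a b + if a ∈ cU.order s.I ∧ b = s.hv c then
          X (s.log.length + (cU.order s.I).idxOf a) a (s.hv c) else 0
        Cv := fun a b => s.Cv a b + if a = s.hu r ∧ b ∈ cV.order s.J then
          X (s.log.length + (cU.order s.I).length + (cV.order s.J).idxOf b) (s.hu r) b else 0 } := by
  simp only [State.explore]
  rw [foldl_pullU _ _ _ (cU.nodup_order _), foldl_pullV _ _ _ (cV.nodup_order _)]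
  simp

@[simp] theorem explore_hu : (s.explore cU cV X c r).hu = s.hu := by rw [explore_eq]

@[simp] theorem explore_hv : (s.explore cU cV X c r).hv = s.hv := by rw [explore_eq]

/-- The sum of the rewards collected for row `i`. -/
def State.rowSum (s : State K L) (i : Fin K) : ℝ := ∑ j, s.Cu i j

/-- The sum of the rewards collected for column `j`. -/
def State.colSum (s : State K L) (j : Fin L) : ℝ := ∑ i, s.Cv i j

/-- The time at which row `i` is played in the next exploration. -/
def State.rowTime (i : Fin K) : ℕ := s.log.length + (cU.order s.I).idxOf i

/-- The time at which column `j` is played in the next exploration. -/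
def State.colTime (j : Fin L) : ℕ :=
  s.log.length + (cU.order s.I).length + (cV.order s.J).idxOf j

theorem explore_rowSum (i : Fin K) :
    (s.explore cU cV X c r).rowSum i =
      s.rowSum i + if i ∈ s.I then X (s.rowTime cU i) i (s.hv c) else 0 := by
  rw [explore_eq]
  simp only [State.rowSum, Finset.sum_add_distrib, cU.mem_order, State.rowTime]
  congr 1
  by_cases h : i ∈ s.I <;> simp [h]

theorem explore_colSum (j : Fin L) :
    (s.explore cU cV X c r).colSum j =
      s.colSum j + if j ∈ s.J then X (s.colTime cU cV j) (s.hu r) j else 0 := by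
  rw [explore_eq]
  simp only [State.colSum, Finset.sum_add_distrib, cV.mem_order, State.colTime]
  congr 1
  by_cases h : j ∈ s.J <;> simp [h]

theorem sum_map_order {ι : Type} (C : Convention ι) (s : Finset ι) (f : ι → ℝ) :
    ((C.order s).map f).sum = ∑ i ∈ s, f i := by
  classical
  rw [← List.sum_toFinset f (C.nodup_order s)]
  congr 1
  ext i
  simp [C.mem_order]

theorem explore_sum_log (g : Fin K × Fin L → ℝ) :
    ((s.explore cU cV X c r).log.map g).sum =
      (s.log.map g).sum + (∑ i ∈ s.I, g (i, s.hv c) + ∑ j ∈ s.J, g (s.hu r, j)) := by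
  rw [explore_eq]
  simp only [List.map_append, List.sum_append, List.map_map, add_assoc]
  rw [sum_map_order cU, sum_map_order cV]
  rfl

end Explore

/-! ### The algorithm as a sequence of explorations -/

section Iterate

variable (cU : Convention (Fin K)) (cV : Convention (Fin L)) (n : ℕ)
  (X : ℕ → Fin K → Fin L → ℝ) (col : ℕ → Fin L) (row : ℕ → Fin K)

open Classical in
/-- The elimination that follows the `k`-th exploration, if there is one. -/
def State.maybeEliminate (k : ℕ) (s : State K L) : State K L :=
  if h : ∃ ℓ, iters n ℓ = k then s.eliminate cU cV n (Nat.find h) else s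

/-- The variables after `k` explorations and the eliminations that are then due. -/
def iterate : ℕ → State K L
  | 0 => State.init K L
  | k + 1 => ((iterate k).explore cU cV X (col k) (row k)).maybeEliminate cU cV n (k + 1)

theorem iters_strictMono {n : ℕ} (hn : 2 ≤ n) : StrictMono (iters n) :=
  strictMono_nat_of_lt_succ fun ℓ => iters_lt_succ hn (ℓ + 1)

theorem iters_ne_of_mem_stage {n : ℕ} (hn : 2 ≤ n) {ℓ k : ℕ} (h1 : prevIters n ℓ < k)
    (h2 : k < iters n ℓ) : ¬∃ m, iters n m = k := by
  rintro ⟨m, rfl⟩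
  have h3 : m < ℓ := (iters_strictMono hn).lt_iff_lt.1 h2
  obtain ⟨p, rfl⟩ : ∃ p, ℓ = p + 1 := ⟨ℓ - 1, by omega⟩
  have h4 : p < m := (iters_strictMono hn).lt_iff_lt.1 h1
  omega

variable {n}

/-- Since `iters n` is injective, the stage found by `Nat.find` can only be `ℓ`. -/
theorem maybeEliminate_iters (hn : 2 ≤ n) (ℓ : ℕ) (s : State K L) :
    s.maybeEliminate cU cV n (iters n ℓ) = s.eliminate cU cV n ℓ := by
  classical
  have h : ∃ m, iters n m = iters n ℓ := ⟨ℓ, rfl⟩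
  rw [State.maybeEliminate, dif_pos h]
  congr 1
  exact (iters_strictMono hn).injective (Nat.find_spec h)

/-- The upper bound on `k` is strict because at `iters n ℓ` the iteration also eliminates, which the
fold does not. -/
theorem foldl_explore_eq_iterate (hn : 2 ≤ n) (ℓ k : ℕ) (h1 : prevIters n ℓ ≤ k)
    (h2 : k < iters n ℓ) :
    (List.Ico (prevIters n ℓ) k).foldl (fun s' k => s'.explore cU cV X (col k) (row k))
      (iterate cU cV n X col row (prevIters n ℓ)) = iterate cU cV n X col row k := by
  induction k, h1 using Nat.le_induction with
  | base => simp
  | succ k hk ih =>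
    rw [List.Ico.succ_top hk, List.foldl_append, ih (by omega)]
    simp only [List.foldl_cons, List.foldl_nil, iterate]
    rw [State.maybeEliminate, dif_neg (iters_ne_of_mem_stage hn (by omega) h2)]

/-- Numbering by explorations instead of stages supplies the time index of the martingales. -/
theorem run_eq_iterate (hn : 2 ≤ n) (ℓ : ℕ) :
    run cU cV n X col row ℓ = iterate cU cV n X col row (prevIters n ℓ) := by
  induction ℓ with
  | zero => rfl
  | succ ℓ ih =>
    have h := iters_lt_succ hn ℓ
    obtain ⟨k, hk⟩ : ∃ k, iters n ℓ = k + 1 := ⟨iters n ℓ - 1, by omega⟩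
    have hkp : prevIters n ℓ ≤ k := by omega
    rw [run, State.stage, ih, hk, List.Ico.succ_top hkp, List.foldl_append,
      foldl_explore_eq_iterate cU cV X col row hn ℓ k hkp (by omega)]
    change _ = iterate cU cV n X col row (iters n ℓ)
    rw [hk, iterate, ← hk, maybeEliminate_iters cU cV hn]
    rfl

variable (n)

@[simp] theorem maybeEliminate_log (k : ℕ) (s : State K L) :
    (s.maybeEliminate cU cV n k).log = s.log := by
  rw [State.maybeEliminate]; split_ifs <;> rfl

@[simp] theorem maybeEliminate_rowSum (k : ℕ) (s : State K L) :
    (s.maybeEliminate cU cV n k).rowSum = s.rowSum := by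
  rw [State.maybeEliminate]; split_ifs <;> rfl

@[simp] theorem maybeEliminate_colSum (k : ℕ) (s : State K L) :
    (s.maybeEliminate cU cV n k).colSum = s.colSum := by
  rw [State.maybeEliminate]; split_ifs <;> rfl

theorem eliminate_I_subset (ℓ : ℕ) (s : State K L) : (s.eliminate cU cV n ℓ).I ⊆ s.I := by
  intro i hi
  obtain ⟨a, -, rfl⟩ := Finset.mem_image.1 hi
  have ha : s.hu a ∈ s.I := Finset.mem_image_of_mem _ (Finset.mem_univ _)
  simp only [State.eliminate]
  split_ifs
  · exact cU.pick_mem _ _ ⟨_, ha⟩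
  · exact ha

theorem eliminate_J_subset (ℓ : ℕ) (s : State K L) : (s.eliminate cU cV n ℓ).J ⊆ s.J := by
  intro i hi
  obtain ⟨a, -, rfl⟩ := Finset.mem_image.1 hi
  have ha : s.hv a ∈ s.J := Finset.mem_image_of_mem _ (Finset.mem_univ _)
  simp only [State.eliminate]
  split_ifs
  · exact cV.pick_mem _ _ ⟨_, ha⟩
  · exact ha

/-- Consequently a row that remains now has been played in every earlier exploration. -/
theorem iterate_I_antitone : Antitone fun k => (iterate cU cV n X col row k).I := by
  refine antitone_nat_of_succ_le fun k => ?_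
  have h : ((iterate cU cV n X col row k).explore cU cV X (col k) (row k)).I =
      (iterate cU cV n X col row k).I := by simp [State.I]
  rw [iterate, State.maybeEliminate]
  split_ifs
  · exact (eliminate_I_subset cU cV n _ _).trans h.le
  · exact h.le

theorem iterate_J_antitone : Antitone fun k => (iterate cU cV n X col row k).J := by
  refine antitone_nat_of_succ_le fun k => ?_
  have h : ((iterate cU cV n X col row k).explore cU cV X (col k) (row k)).J =
      (iterate cU cV n X col row k).J := by simp [State.J]
  rw [iterate, State.maybeEliminate]
  split_ifs
  · exact (eliminate_J_subset cU cV n _ _).trans h.le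
  · exact h.le

theorem iterate_succ_rowSum (k : ℕ) (i : Fin K) :
    (iterate cU cV n X col row (k + 1)).rowSum i =
      (iterate cU cV n X col row k).rowSum i + if i ∈ (iterate cU cV n X col row k).I then
        X ((iterate cU cV n X col row k).rowTime cU i) i
          ((iterate cU cV n X col row k).hv (col k)) else 0 := by
  rw [iterate, maybeEliminate_rowSum, explore_rowSum]

theorem iterate_succ_colSum (k : ℕ) (j : Fin L) :
    (iterate cU cV n X col row (k + 1)).colSum j =
      (iterate cU cV n X col row k).colSum j + if j ∈ (iterate cU cV n X col row k).J then
        X ((iterate cU cV n X col row k).colTime cU cV j)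
          ((iterate cU cV n X col row k).hu (row k)) j else 0 := by
  rw [iterate, maybeEliminate_colSum, explore_colSum]

/-! ### Dependence on the rewards and the random draws -/

/-- Two states of runs whose rewards agree before time `t`: either they are equal, or both runs
have passed time `t` and chose the same arm at time `t`. -/
def SameUpTo (t : ℕ) (s s' : State K L) : Prop :=
  (s = s' ∧ s.log.length ≤ t) ∨
    (t < s.log.length ∧ t < s'.log.length ∧ s.log[t]? = s'.log[t]?)

variable {X} {X' : ℕ → Fin K → Fin L → ℝ} {t : ℕ}

/-- Logs only grow, so an entry once written at time `t` stays, however the two runs diverge later.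
-/
theorem SameUpTo.of_append {s s' r r' : State K L} (h : t < s.log.length)
    (h' : t < s'.log.length) (he : s.log[t]? = s'.log[t]?) (l l' : List (Fin K × Fin L))
    (hr : r.log = s.log ++ l) (hr' : r'.log = s'.log ++ l') : SameUpTo t r r' := by
  refine Or.inr ⟨?_, ?_, ?_⟩
  · rw [hr, List.length_append]; omega
  · rw [hr', List.length_append]; omega
  · rw [hr, hr', List.getElem?_append_left h, List.getElem?_append_left h', he]

theorem SameUpTo.pullU (hX : ∀ a < t, X a = X' a) {s s' : State K L} (h : SameUpTo t s s')
    (i : Fin K) (j : Fin L) : SameUpTo t (s.pullU X i j) (s'.pullU X' i j) := by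
  rcases h with ⟨rfl, hs⟩ | ⟨h1, h2, h3⟩
  · rcases hs.lt_or_eq with hs | hs
    · refine Or.inl ⟨?_, by simpa [State.pullU] using hs⟩
      simp [State.pullU, hX _ hs]
    -- The play happens exactly at time `t`: the rewards may differ, but the arm was chosen before
    -- they are seen.
    · refine Or.inr ?_
      simp [State.pullU, hs]
  · exact SameUpTo.of_append h1 h2 h3 _ _ rfl rfl

theorem SameUpTo.pullV (hX : ∀ a < t, X a = X' a) {s s' : State K L} (h : SameUpTo t s s')
    (i : Fin K) (j : Fin L) : SameUpTo t (s.pullV X i j) (s'.pullV X' i j) := by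
  rcases h with ⟨rfl, hs⟩ | ⟨h1, h2, h3⟩
  · rcases hs.lt_or_eq with hs | hs
    · refine Or.inl ⟨?_, by simpa [State.pullV] using hs⟩
      simp [State.pullV, hX _ hs]
    · refine Or.inr ?_
      simp [State.pullV, hs]
  · exact SameUpTo.of_append h1 h2 h3 _ _ rfl rfl

theorem SameUpTo.explore (hX : ∀ a < t, X a = X' a) {s s' : State K L} (h : SameUpTo t s s')
    (c : Fin L) (r : Fin K) :
    SameUpTo t (s.explore cU cV X c r) (s'.explore cU cV X' c r) := by
  rcases h with ⟨rfl, hs⟩ | ⟨h1, h2, h3⟩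
  · have hU : ∀ (l : List (Fin K)) (j : Fin L) (s s' : State K L), SameUpTo t s s' →
        SameUpTo t (l.foldl (fun s' i => s'.pullU X i j) s)
          (l.foldl (fun s' i => s'.pullU X' i j) s') := by
      intro l j
      induction l with
      | nil => exact fun _ _ h => h
      | cons i l ih => exact fun s s' h => ih _ _ (h.pullU hX i j)
    have hV : ∀ (l : List (Fin L)) (i : Fin K) (s s' : State K L), SameUpTo t s s' →
        SameUpTo t (l.foldl (fun s' j => s'.pullV X i j) s)
          (l.foldl (fun s' j => s'.pullV X' i j) s') := by
      intro l i
      induction l with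
      | nil => exact fun _ _ h => h
      | cons j l ih => exact fun s s' h => ih _ _ (h.pullV hX i j)
    exact hV _ _ _ _ (hU _ _ _ _ (Or.inl ⟨rfl, hs⟩))
  -- The two states may now have different remaining sets; only the fact that both logs are extended
  -- matters.
  · rw [explore_eq, explore_eq]
    exact SameUpTo.of_append h1 h2 h3 _ _ (List.append_assoc _ _ _) (List.append_assoc _ _ _)

theorem SameUpTo.maybeEliminate {s s' : State K L} (h : SameUpTo t s s') (k : ℕ) :
    SameUpTo t (s.maybeEliminate cU cV n k) (s'.maybeEliminate cU cV n k) := by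
  rcases h with ⟨rfl, hs⟩ | h
  · exact Or.inl ⟨rfl, by simpa using hs⟩
  · exact Or.inr (by simpa using h)

theorem sameUpTo_iterate (hX : ∀ a < t, X a = X' a) (k : ℕ) :
    SameUpTo t (iterate cU cV n X col row k) (iterate cU cV n X' col row k) := by
  induction k with
  | zero => exact Or.inl ⟨rfl, Nat.zero_le _⟩
  | succ k ih => exact (ih.explore cU cV hX _ _).maybeEliminate cU cV n _

variable {col row} {col' : ℕ → Fin L} {row' : ℕ → Fin K}

theorem iterate_congr_draws (k : ℕ) (hc : ∀ a < k, col a = col' a) (hr : ∀ a < k, row a = row' a) :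
    iterate cU cV n X col row k = iterate cU cV n X col' row' k := by
  induction k with
  | zero => rfl
  | succ k ih =>
    rw [iterate, iterate, ih (fun a ha => hc a (by omega)) (fun a ha => hr a (by omega)),
      hc k (by omega), hr k (by omega)]

/-- The variables after `k` explorations depend only on the first `k` draws and the rewards
observed so far. -/
theorem iterate_congr (k : ℕ) (hX : ∀ a < (iterate cU cV n X col row k).log.length, X a = X' a)
    (hc : ∀ a < k, col a = col' a) (hr : ∀ a < k, row a = row' a) :
    iterate cU cV n X' col' row' k = iterate cU cV n X col row k := by
  rw [← iterate_congr_draws cU cV n k hc hr]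
  -- The time `t` is taken to be the length of the log of the first run, which rules out the second
  -- alternative.
  rcases sameUpTo_iterate cU cV n col row hX k with h | h
  · exact h.1.symm
  · exact absurd h.1 (lt_irrefl _)

/-- The arm chosen at time `t` depends only on the rewards before time `t` and on the draws made
in the first `n` stages. -/
theorem arm_congr [NeZero K] [NeZero L] (hn : 2 ≤ n) (hX : ∀ a < t, X a = X' a)
    (hc : ∀ a < prevIters n n, col a = col' a) (hr : ∀ a < prevIters n n, row a = row' a) :
    arm cU cV n X' col' row' t = arm cU cV n X col row t := by
  have h := sameUpTo_iterate cU cV n col row hX (prevIters n n)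
  rw [iterate_congr_draws cU cV n (X := X') _ hc hr, ← run_eq_iterate cU cV _ _ _ hn,
    ← run_eq_iterate cU cV _ _ _ hn] at h
  rw [arm, arm, List.getD_eq_getElem?_getD, List.getD_eq_getElem?_getD]
  rcases h with h | h
  · rw [h.1]
  · rw [h.2.2]

theorem length_log_iterate_mono [NeZero K] :
    Monotone fun k => (iterate cU cV n X col row k).log.length := by
  refine monotone_nat_of_le_succ fun k => ?_
  have h := length_log_explore cU cV X (col k) (row k) (iterate cU cV n X col row k)
  simp only [iterate, maybeEliminate_log]
  omega

end Iterate

/-! ### Measurability -/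

instance : MeasurableSpace (List (Fin K × Fin L)) := ⊤

instance : DiscreteMeasurableSpace (List (Fin K × Fin L)) := ⟨fun _ => trivial⟩

/-- The components of a state. -/
def State.toTuple (s : State K L) : List (Fin K × Fin L) × (Fin K → Fin L → ℝ) ×
    (Fin K → Fin L → ℝ) × (Fin K → Fin K) × (Fin L → Fin L) :=
  (s.log, s.Cu, s.Cv, s.hu, s.hv)

/-- The pulled-back structure reduces measurability of a random state to that of its five
components. -/
instance : MeasurableSpace (State K L) := MeasurableSpace.comap State.toTuple inferInstance

theorem measurable_toTuple : Measurable (State.toTuple : State K L → _) := comap_measurable _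

theorem measurable_log : Measurable (State.log : State K L → _) := measurable_toTuple.fst

theorem measurable_Cu : Measurable (State.Cu : State K L → _) := measurable_toTuple.snd.fst

theorem measurable_Cv : Measurable (State.Cv : State K L → _) := measurable_toTuple.snd.snd.fst

theorem measurable_hu : Measurable (State.hu : State K L → _) :=
  measurable_toTuple.snd.snd.snd.fst

theorem measurable_hv : Measurable (State.hv : State K L → _) :=
  measurable_toTuple.snd.snd.snd.snd

variable {α β D : Type*} [MeasurableSpace α] [MeasurableSpace β] [MeasurableSpace D]

theorem measurable_state {f : α → State K L} (h1 : Measurable fun a => (f a).log)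
    (h2 : Measurable fun a => (f a).Cu) (h3 : Measurable fun a => (f a).Cv)
    (h4 : Measurable fun a => (f a).hu) (h5 : Measurable fun a => (f a).hv) : Measurable f :=
  measurable_comap_iff.2 (h1.prodMk (h2.prodMk (h3.prodMk (h4.prodMk h5))))

/-- A function that depends on a discrete parameter may be evaluated at a measurable choice of the
parameter. -/
theorem measurable_of_countable_param [Countable D] [MeasurableSingletonClass D] {d : α → D}
    (hd : Measurable d) {F : D → α → β} (hF : ∀ x, Measurable (F x)) :
    Measurable fun a => F (d a) a := by
  have h : Measurable fun p : α × D => F p.2 p.1 := measurable_from_prod_countable_left hF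
  exact h.comp (measurable_id.prodMk hd)

section

variable {S : α → State K L} {X : α → ℕ → Fin K → Fin L → ℝ}

theorem measurable_pullU (hS : Measurable S) (hX : Measurable X) (i : Fin K) (j : Fin L) :
    Measurable fun a => (S a).pullU (X a) i j := by
  have hl : Measurable fun a => (S a).log := measurable_log.comp hS
  have hlen : Measurable fun a => (S a).log.length :=
    (Measurable.of_discrete (f := List.length)).comp hl
  have hC : Measurable fun a => (S a).Cu := measurable_Cu.comp hS
  have hC' : Measurable fun a => (S a).Cv := measurable_Cv.comp hS
  have hu : Measurable fun a => (S a).hu := measurable_hu.comp hS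
  have hv : Measurable fun a => (S a).hv := measurable_hv.comp hS
  refine measurable_state ?_ ?_ hC' hu hv
  · exact (Measurable.of_discrete (f := fun l => l ++ [(i, j)])).comp hl
  · refine measurable_pi_lambda _ fun b => measurable_pi_lambda _ fun c => ?_
    refine ((measurable_pi_apply c).comp ((measurable_pi_apply b).comp hC)).add ?_
    split_ifs
    · exact measurable_of_countable_param (F := fun m a => X a m i j) hlen fun m => by fun_prop
    · exact measurable_const

theorem measurable_pullV (hS : Measurable S) (hX : Measurable X) (i : Fin K) (j : Fin L) :
    Measurable fun a => (S a).pullV (X a) i j := by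
  have hl : Measurable fun a => (S a).log := measurable_log.comp hS
  have hlen : Measurable fun a => (S a).log.length :=
    (Measurable.of_discrete (f := List.length)).comp hl
  have hC : Measurable fun a => (S a).Cv := measurable_Cv.comp hS
  have hC' : Measurable fun a => (S a).Cu := measurable_Cu.comp hS
  have hu : Measurable fun a => (S a).hu := measurable_hu.comp hS
  have hv : Measurable fun a => (S a).hv := measurable_hv.comp hS
  refine measurable_state ?_ hC' ?_ hu hv
  · exact (Measurable.of_discrete (f := fun l => l ++ [(i, j)])).comp hl
  · refine measurable_pi_lambda _ fun b => measurable_pi_lambda _ fun c => ?_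
    refine ((measurable_pi_apply c).comp ((measurable_pi_apply b).comp hC)).add ?_
    split_ifs
    · exact measurable_of_countable_param (F := fun m a => X a m i j) hlen fun m => by fun_prop
    · exact measurable_const

theorem measurable_foldl_pullU (hX : Measurable X) (j : Fin L) (l : List (Fin K))
    (hS : Measurable S) :
    Measurable fun a => l.foldl (fun s' i => s'.pullU (X a) i j) (S a) := by
  induction l generalizing S with
  | nil => exact hS
  | cons i l ih => exact ih (measurable_pullU hS hX i j)

theorem measurable_foldl_pullV (hX : Measurable X) (i : Fin K) (l : List (Fin L))
    (hS : Measurable S) :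
    Measurable fun a => l.foldl (fun s' j => s'.pullV (X a) i j) (S a) := by
  induction l generalizing S with
  | nil => exact hS
  | cons j l ih => exact ih (measurable_pullV hS hX i j)

variable (cU : Convention (Fin K)) (cV : Convention (Fin L))

theorem measurable_explore (hS : Measurable S) (hX : Measurable X) {c : α → Fin L} {r : α → Fin K}
    (hc : Measurable c) (hr : Measurable r) :
    Measurable fun a => (S a).explore cU cV (X a) (c a) (r a) := by
  have hu : Measurable fun a => (S a).hu := measurable_hu.comp hS
  have hv : Measurable fun a => (S a).hv := measurable_hv.comp hS
  -- Once `hu`, `hv` and the two draws are fixed, which leaves finitely many cases, the exploration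
  -- is a fixed list of plays.
  exact measurable_of_countable_param
    (F := fun (d : ((Fin K → Fin K) × (Fin L → Fin L)) × Fin L × Fin K) a =>
      (cV.order (Finset.univ.image d.1.2)).foldl (fun s' j => s'.pullV (X a) (d.1.1 d.2.2) j)
        ((cU.order (Finset.univ.image d.1.1)).foldl
          (fun s' i => s'.pullU (X a) i (d.1.2 d.2.1)) (S a)))
    ((hu.prodMk hv).prodMk (hc.prodMk hr))
    fun d => measurable_foldl_pullV hX _ _ (measurable_foldl_pullU hX _ _ hS)

theorem measurable_pick {m : ℕ} (C : Convention (Fin m)) (s : Finset (Fin m)) :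
    Measurable (C.pick s) :=
  measurable_to_countable' fun i => C.measurable_pick s i

variable (n : ℕ)

theorem measurable_eliminate (hS : Measurable S) (ℓ : ℕ) :
    Measurable fun a => (S a).eliminate cU cV n ℓ := by
  have hu : Measurable fun a => (S a).hu := measurable_hu.comp hS
  have hv : Measurable fun a => (S a).hv := measurable_hv.comp hS
  have hCu : ∀ i j, Measurable fun a => (S a).Cu i j := fun i j =>
    (measurable_pi_apply j).comp ((measurable_pi_apply i).comp (measurable_Cu.comp hS))
  have hCv : ∀ i j, Measurable fun a => (S a).Cv i j := fun i j =>
    (measurable_pi_apply j).comp ((measurable_pi_apply i).comp (measurable_Cv.comp hS))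
  have hLu : ∀ i, Measurable fun a => (S a).lcbU n ℓ i := fun i =>
    ((Finset.measurable_fun_sum _ fun j _ => hCu i j).const_mul _).sub_const _
  have hUu : ∀ i, Measurable fun a => (S a).ucbU n ℓ i := fun i =>
    ((Finset.measurable_fun_sum _ fun j _ => hCu i j).const_mul _).add_const _
  have hLv : ∀ j, Measurable fun a => (S a).lcbV n ℓ j := fun j =>
    ((Finset.measurable_fun_sum _ fun i _ => hCv i j).const_mul _).sub_const _
  have hUv : ∀ j, Measurable fun a => (S a).ucbV n ℓ j := fun j =>
    ((Finset.measurable_fun_sum _ fun i _ => hCv i j).const_mul _).add_const _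
  have hpu : Measurable fun a => cU.pick (S a).I ((S a).lcbU n ℓ) :=
    measurable_of_countable_param
      (F := fun (h : Fin K → Fin K) a => cU.pick (Finset.univ.image h) ((S a).lcbU n ℓ)) hu
      fun h => (measurable_pick cU _).comp (measurable_pi_lambda _ hLu)
  have hpv : Measurable fun a => cV.pick (S a).J ((S a).lcbV n ℓ) :=
    measurable_of_countable_param
      (F := fun (h : Fin L → Fin L) a => cV.pick (Finset.univ.image h) ((S a).lcbV n ℓ)) hv
      fun h => (measurable_pick cV _).comp (measurable_pi_lambda _ hLv)
  have hl : Measurable fun a => (S a).log := measurable_log.comp hS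
  have hC : Measurable fun a => (S a).Cu := measurable_Cu.comp hS
  have hC' : Measurable fun a => (S a).Cv := measurable_Cv.comp hS
  refine measurable_state hl hC hC' (measurable_pi_lambda _ fun i => ?_)
    (measurable_pi_lambda _ fun j => ?_)
  · exact measurable_of_countable_param
      (F := fun (d : (Fin K → Fin K) × Fin K) a =>
        if (S a).ucbU n ℓ (d.1 i) ≤ (S a).lcbU n ℓ d.2 then d.2 else d.1 i) (hu.prodMk hpu)
      fun d => Measurable.ite (measurableSet_le (hUu _) (hLu _)) measurable_const measurable_const
  · exact measurable_of_countable_param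
      (F := fun (d : (Fin L → Fin L) × Fin L) a =>
        if (S a).ucbV n ℓ (d.1 j) ≤ (S a).lcbV n ℓ d.2 then d.2 else d.1 j) (hv.prodMk hpv)
      fun d => Measurable.ite (measurableSet_le (hUv _) (hLv _)) measurable_const measurable_const

theorem measurable_maybeEliminate (hS : Measurable S) (k : ℕ) :
    Measurable fun a => (S a).maybeEliminate cU cV n k := by
  unfold State.maybeEliminate
  split_ifs
  · exact measurable_eliminate cU cV n hS _
  · exact hS

theorem measurable_reward : Measurable (reward : Sample K L → _) := by
  refine measurable_pi_lambda _ fun t => measurable_pi_lambda _ fun i =>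
    measurable_pi_lambda _ fun j => ?_
  unfold reward
  fun_prop

/-- The variables after `k` explorations, as a random variable. -/
def stateAt (k : ℕ) (ω : Sample K L) : State K L :=
  iterate cU cV n (reward ω) ω.2.2.1 ω.2.2.2 k

theorem measurable_stateAt (k : ℕ) : Measurable (stateAt cU cV n k) := by
  induction k with
  | zero => exact measurable_const
  | succ k ih =>
    exact measurable_maybeEliminate cU cV n
      (measurable_explore cU cV ih measurable_reward (by fun_prop) (by fun_prop)) _

theorem measurable_arm [NeZero K] [NeZero L] (hn : 2 ≤ n) (t : ℕ) :
    Measurable fun ω : Sample K L => arm cU cV n (reward ω) ω.2.2.1 ω.2.2.2 t := by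
  have h : ∀ ω : Sample K L, arm cU cV n (reward ω) ω.2.2.1 ω.2.2.2 t =
      (fun l : List (Fin K × Fin L) => l.getD t (0, 0))
        (stateAt cU cV n (prevIters n n) ω).log := fun ω => by
    rw [arm, run_eq_iterate cU cV _ _ _ hn]; rfl
  simp only [h]
  exact (Measurable.of_discrete (f := fun l : List (Fin K × Fin L) => l.getD t (0, 0))).comp
    (measurable_log.comp (measurable_stateAt cU cV n _))

end

/-! ### Resampling the future -/

section Splice

variable {α β : Type*}

/-- The first `d` entries of `x`, followed by the remaining entries of `y`. -/
def splice (d : ℕ) (x y : ℕ → α) : ℕ → α := fun t => if t < d then x t else y t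

theorem splice_of_lt {d t : ℕ} (h : t < d) (x y : ℕ → α) : splice d x y t = x t := if_pos h

theorem splice_of_le {d t : ℕ} (h : d ≤ t) (x y : ℕ → α) : splice d x y t = y t :=
  if_neg h.not_gt

theorem splice_splice (d : ℕ) (x y : ℕ → α) : splice d (splice d x y) x = x := by
  funext t; simp only [splice]; split_ifs <;> rfl

variable [MeasurableSpace α] [MeasurableSpace β]

/-- It suffices to test finite-dimensional boxes: the sides before `d` constrain only the first
sequence and the others only the second, and the two probabilities multiply. -/
theorem measurePreserving_splice (P : Measure α) [IsProbabilityMeasure P] (d : ℕ) :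
    MeasurePreserving (fun p : (ℕ → α) × (ℕ → α) => splice d p.1 p.2)
      ((Measure.infinitePi fun _ : ℕ => P).prod (Measure.infinitePi fun _ : ℕ => P))
      (Measure.infinitePi fun _ : ℕ => P) := by
  have hm : Measurable fun p : (ℕ → α) × (ℕ → α) => splice d p.1 p.2 := by
    refine measurable_pi_lambda _ fun t => ?_
    unfold splice
    split_ifs <;> fun_prop
  refine ⟨hm, Measure.eq_infinitePi _ fun s B hB => ?_⟩
  rw [Measure.map_apply hm (MeasurableSet.pi s.countable_toSet fun i _ => hB i)]
  have hset : (fun p : (ℕ → α) × (ℕ → α) => splice d p.1 p.2) ⁻¹' Set.pi s B =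
      Set.pi (s.filter (· < d) : Finset ℕ) B ×ˢ Set.pi (s.filter (¬· < d) : Finset ℕ) B := by
    ext p
    simp only [Set.mem_preimage, Set.mem_pi, Finset.mem_coe, Set.mem_prod, Finset.mem_filter,
      splice]
    constructor
    · intro h
      exact ⟨fun t ht => by simpa [ht.2] using h t ht.1,
        fun t ht => by simpa [ht.2] using h t ht.1⟩
    · rintro ⟨h1, h2⟩ t ht
      split_ifs with htd
      · exact h1 t ⟨ht, htd⟩
      · exact h2 t ⟨ht, htd⟩
  rw [hset, Measure.prod_prod, Measure.infinitePi_pi _ fun i _ => hB i,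
    Measure.infinitePi_pi _ fun i _ => hB i, Finset.prod_filter_mul_prod_filter_not]

/-- Exchanging the two middle factors pairs each component with its copy, so the splice of a whole
sample is assembled factor by factor. -/
theorem measurePreserving_prod_prod {μ : Measure α} {ν : Measure β} [SFinite μ] [SFinite ν]
    {f : α × α → α} {g : β × β → β} (hf : MeasurePreserving f (μ.prod μ) μ)
    (hg : MeasurePreserving g (ν.prod ν) ν) :
    MeasurePreserving (fun p : (α × β) × (α × β) => (f (p.1.1, p.2.1), g (p.1.2, p.2.2)))
      ((μ.prod ν).prod (μ.prod ν)) (μ.prod ν) :=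
  have h1 : MeasurePreserving (fun p : (α × β) × (α × β) => (p.1.1, p.1.2, p.2))
      ((μ.prod ν).prod (μ.prod ν)) (μ.prod (ν.prod (μ.prod ν))) :=
    measurePreserving_prodAssoc μ ν (μ.prod ν)
  have h2 : MeasurePreserving (fun p : β × (α × β) => (p.2.1, (p.1, p.2.2)))
      (ν.prod (μ.prod ν)) (μ.prod (ν.prod ν)) :=
    (measurePreserving_prodAssoc μ ν ν).comp
      ((Measure.measurePreserving_swap.prod (MeasurePreserving.id ν)).comp
        (MeasurePreserving.symm MeasurableEquiv.prodAssoc (measurePreserving_prodAssoc ν μ ν)))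
  have h3 : MeasurePreserving (fun p : α × (α × (β × β)) => ((p.1, p.2.1), p.2.2))
      (μ.prod (μ.prod (ν.prod ν))) ((μ.prod μ).prod (ν.prod ν)) :=
    MeasurePreserving.symm MeasurableEquiv.prodAssoc (measurePreserving_prodAssoc μ μ (ν.prod ν))
  (hf.prod hg).comp (h3.comp (((MeasurePreserving.id μ).prod h2).comp h1))

end Splice

/-- The vectors before time `d` and the first `k` random draws of `ω`, continued by `ω'`. -/
def spliceSample (d k : ℕ) (ω ω' : Sample K L) : Sample K L :=
  (splice d ω.1 ω'.1, splice d ω.2.1 ω'.2.1, splice k ω.2.2.1 ω'.2.2.1,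
    splice k ω.2.2.2 ω'.2.2.2)

theorem reward_spliceSample_of_lt {d t : ℕ} (k : ℕ) (h : t < d) (ω ω' : Sample K L) :
    reward (spliceSample d k ω ω') t = reward ω t := by
  funext i j
  simp only [reward, spliceSample, splice_of_lt h]

theorem reward_spliceSample_of_le {d t : ℕ} (k : ℕ) (h : d ≤ t) (ω ω' : Sample K L) :
    reward (spliceSample d k ω ω') t = reward ω' t := by
  funext i j
  simp only [reward, spliceSample, splice_of_le h]

theorem spliceSample_spliceSample (d k : ℕ) (ω ω' : Sample K L) :
    spliceSample d k (spliceSample d k ω ω') ω = ω := by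
  simp only [spliceSample, splice_splice]

section Law

variable [NeZero K] [NeZero L] (PU : Measure (Fin K → unitInterval)) [IsProbabilityMeasure PU]
  (PV : Measure (Fin L → unitInterval)) [IsProbabilityMeasure PV]

instance : IsProbabilityMeasure (law PU PV) := by unfold law; infer_instance

theorem measurePreserving_spliceSample (d k : ℕ) :
    MeasurePreserving (fun p : Sample K L × Sample K L => spliceSample d k p.1 p.2)
      ((law PU PV).prod (law PU PV)) (law PU PV) :=
  measurePreserving_prod_prod (measurePreserving_splice PU d)
    (measurePreserving_prod_prod (measurePreserving_splice PV d)
      (measurePreserving_prod_prod (measurePreserving_splice (uniform L) k)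
        (measurePreserving_splice (uniform K) k)))

/-- The strong Markov property: replacing everything after a stopping time by an independent
copy does not change the law. -/
theorem measurePreserving_spliceSample_stopping {T : Sample K L → ℕ} (hTm : Measurable T) (k : ℕ)
    (hT : ∀ ω ω', T (spliceSample (T ω) k ω ω') = T ω) :
    MeasurePreserving (fun p : Sample K L × Sample K L => spliceSample (T p.1) k p.1 p.2)
      ((law PU PV).prod (law PU PV)) (law PU PV) := by
  have hm : Measurable fun p : Sample K L × Sample K L => spliceSample (T p.1) k p.1 p.2 :=
    measurable_of_countable_param
      (F := fun d (p : Sample K L × Sample K L) => spliceSample d k p.1 p.2)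
      (hTm.comp measurable_fst) fun d => (measurePreserving_spliceSample PU PV d k).measurable
  refine ⟨hm, Measure.ext fun A hA => ?_⟩
  have hlevel : ∀ d, MeasurableSet (T ⁻¹' {d}) := fun d => hTm (measurableSet_singleton d)
  have hdisj : Pairwise (Function.onFun Disjoint fun d => T ⁻¹' {d}) := fun a b hab =>
    Disjoint.preimage _ (Set.disjoint_singleton.2 hab)
  have hA' : A = ⋃ d, A ∩ T ⁻¹' {d} := by
    ext ω; simp
  -- Splicing `ω` back in recovers `ω`, so a spliced sample at level `d` must come from a sample at
  -- level `d`.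
  have hback : ∀ d ω ω', T (spliceSample d k ω ω') = d → T ω = d := by
    intro d ω ω' h
    have h3 := hT (spliceSample d k ω ω') ω
    rwa [h, spliceSample_spliceSample] at h3
  rw [Measure.map_apply hm hA]
  -- On each level set of `T` the map is a splice at a deterministic time, whose law is already
  -- known.
  have hpre : (fun p : Sample K L × Sample K L => spliceSample (T p.1) k p.1 p.2) ⁻¹' A =
      ⋃ d, (fun p : Sample K L × Sample K L => spliceSample d k p.1 p.2) ⁻¹'
        (A ∩ T ⁻¹' {d}) := by
    ext ⟨ω, ω'⟩
    simp only [Set.mem_preimage, Set.mem_iUnion, Set.mem_inter_iff, Set.mem_singleton_iff]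
    constructor
    · exact fun h => ⟨T ω, h, hT ω ω'⟩
    · rintro ⟨d, h1, h2⟩
      rwa [hback d ω ω' h2]
  have hmd := fun d => (measurePreserving_spliceSample PU PV d k)
  rw [hpre, measure_iUnion, tsum_congr fun d => (hmd d).measure_preimage
    (hA.inter (hlevel d)).nullMeasurableSet, ← measure_iUnion, ← hA']
  · exact fun a b hab => (hdisj hab).mono Set.inter_subset_right Set.inter_subset_right
  · exact fun d => hA.inter (hlevel d)
  · refine fun a b hab => Set.disjoint_left.2 ?_
    rintro ⟨ω, ω'⟩ ⟨-, ha⟩ ⟨-, hb⟩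
    exact hab ((hback a ω ω' ha).symm.trans (hback b ω ω' hb))
  · exact fun d => (hmd d).measurable (hA.inter (hlevel d))

/-! ### Concentration -/

/-- The Azuma-Hoeffding inequality for increments that are, given the past up to a stopping time,
centered functions of the resampled future with values in an interval of length one. -/
theorem hasSubgaussianMGF_of_resampled_increments {M : ℕ → Sample K L → ℝ}
    {T : ℕ → Sample K L → ℕ} (hTm : ∀ k, Measurable (T k))
    (hT : ∀ k ω ω', T k (spliceSample (T k ω) k ω ω') = T k ω)
    (hM : ∀ k, Measurable (M k)) (h0 : ∀ ω, M 0 ω = 0)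
    (hstep : ∀ k ω, ∃ f : Sample K L → ℝ, Measurable f ∧ (∀ ω', f ω' ∈ Set.Icc (0 : ℝ) 1) ∧
      ∀ ω', M (k + 1) (spliceSample (T k ω) k ω ω') = M k ω + (f ω' - ∫ x, f x ∂law PU PV))
    (k : ℕ) : HasSubgaussianMGF (M k) (k / 4) (law PU PV) := by
  -- No bound on `M` is assumed. The Lebesgue integral needs no integrability for the induction, and
  -- the finite bound supplies it afterwards.
  have key : ∀ t : ℝ, ∫⁻ ω, ENNReal.ofReal (Real.exp (t * M k ω)) ∂law PU PV ≤
      ENNReal.ofReal (Real.exp (k / 4 * t ^ 2 / 2)) := by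
    intro t
    induction k with
    | zero => simp [h0]
    | succ k ih =>
      have hF : Measurable fun ω => ENNReal.ofReal (Real.exp (t * M (k + 1) ω)) :=
        (Real.measurable_exp.comp ((hM _).const_mul _)).ennreal_ofReal
      have hMP := measurePreserving_spliceSample_stopping PU PV (hTm k) k (hT k)
      rw [← hMP.lintegral_comp hF]
      refine (lintegral_prod _ (hF.comp hMP.measurable).aemeasurable).trans_le ?_
      calc _ ≤ ∫⁻ ω, ENNReal.ofReal (Real.exp (t * M k ω)) *
              ENNReal.ofReal (Real.exp (1 / 4 * t ^ 2 / 2)) ∂law PU PV := by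
            refine lintegral_mono fun ω => ?_
            obtain ⟨f, hfm, hf, hfe⟩ := hstep k ω
            -- Hoeffding's lemma: an interval of length one gives the variance proxy `1 / 4`.
            have hsub := hasSubgaussianMGF_of_mem_Icc (μ := law PU PV) hfm.aemeasurable
              (Filter.Eventually.of_forall hf)
            simp only [Function.comp_apply, hfe, mul_add, Real.exp_add]
            simp only [ENNReal.ofReal_mul (Real.exp_nonneg _)]
            rw [lintegral_const_mul' _ _ ENNReal.ofReal_ne_top]
            gcongr
            rw [← ofReal_integral_eq_lintegral_ofReal (by simpa only [mul_sub, mul_comm] using hsub.integrable_exp_mul t)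
              (Filter.Eventually.of_forall fun _ => Real.exp_nonneg _)]
            refine ENNReal.ofReal_le_ofReal ?_
            have h := hsub.mgf_le t
            rw [mgf] at h
            refine le_trans (le_of_eq ?_) (h.trans (le_of_eq ?_))
            · rfl
            · congr 3
              simp
              norm_num
        _ ≤ _ := by
            rw [lintegral_mul_const' _ _ ENNReal.ofReal_ne_top]
            refine (mul_le_mul_left ih _).trans (le_of_eq ?_)
            rw [← ENNReal.ofReal_mul (Real.exp_nonneg _), ← Real.exp_add]
            congr 2
            push_cast
            ring
  have hint : ∀ t : ℝ, Integrable (fun ω => Real.exp (t * M k ω)) (law PU PV) := fun t => by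
    refine ⟨(Real.measurable_exp.comp ((hM k).const_mul t)).aestronglyMeasurable, ?_⟩
    rw [hasFiniteIntegral_iff_ofReal (Filter.Eventually.of_forall fun _ => Real.exp_nonneg _)]
    exact (key t).trans_lt ENNReal.ofReal_lt_top
  refine ⟨hint, fun t => ?_⟩
  rw [← ENNReal.ofReal_le_ofReal_iff (Real.exp_nonneg _), mgf,
    ofReal_integral_eq_lintegral_ofReal (hint t)
      (Filter.Eventually.of_forall fun _ => Real.exp_nonneg _)]
  refine (key t).trans (le_of_eq ?_)
  simp

end Law

/-! ### Means -/

theorem mean_nonneg {m : ℕ} (P : Measure (Fin m → unitInterval)) (i : Fin m) : 0 ≤ mean P i :=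
  integral_nonneg fun x => (x i).2.1

theorem integrable_coord {m : ℕ} (P : Measure (Fin m → unitInterval)) [IsProbabilityMeasure P]
    (i : Fin m) : Integrable (fun x => (x i : ℝ)) P :=
  Integrable.of_mem_Icc 0 1 (measurable_subtype_coe.comp (measurable_pi_apply i)).aemeasurable
    (Filter.Eventually.of_forall fun x => (x i).2)

theorem mean_le_one {m : ℕ} (P : Measure (Fin m → unitInterval)) [IsProbabilityMeasure P]
    (i : Fin m) : mean P i ≤ 1 := by
  have h := integral_mono (μ := P) (integrable_coord P i) (integrable_const (1 : ℝ))
    fun x => (x i).2.2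
  simpa [mean] using h

/-- The average of the means `mean P (h c)` over all `c`. -/
def avgMean {m : ℕ} (P : Measure (Fin m → unitInterval)) (h : Fin m → Fin m) : ℝ :=
  1 / (m : ℝ) * ∑ c, mean P (h c)

theorem integral_uniform (m : ℕ) [NeZero m] (f : Fin m → ℝ) :
    ∫ c, f c ∂uniform m = 1 / (m : ℝ) * ∑ c, f c := by
  rw [uniform, PMF.integral_eq_sum, Finset.mul_sum]
  refine Finset.sum_congr rfl fun c _ => ?_
  simp

section Law

variable [NeZero K] [NeZero L] (PU : Measure (Fin K → unitInterval)) [IsProbabilityMeasure PU]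
  (PV : Measure (Fin L → unitInterval)) [IsProbabilityMeasure PV]

theorem measurePreserving_coords (t k : ℕ) :
    MeasurePreserving (fun ω : Sample K L => (ω.1 t, ω.2.1 t, ω.2.2.1 k, ω.2.2.2 k)) (law PU PV)
      (PU.prod (PV.prod ((uniform L).prod (uniform K)))) :=
  (measurePreserving_eval_infinitePi (fun _ : ℕ => PU) t).prod
    ((measurePreserving_eval_infinitePi (fun _ : ℕ => PV) t).prod
      ((measurePreserving_eval_infinitePi (fun _ : ℕ => uniform L) k).prod
        (measurePreserving_eval_infinitePi (fun _ : ℕ => uniform K) k)))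

theorem measurable_apply_countable_param {α D : Type*} [MeasurableSpace α] [MeasurableSpace D]
    [Countable D] [MeasurableSingletonClass D] {m : ℕ} {x : α → Fin m → unitInterval}
    (hx : Measurable x) {d : α → D} (hd : Measurable d) (h : D → Fin m) :
    Measurable fun a => (x a (h (d a)) : ℝ) :=
  measurable_of_countable_param (F := fun c a => (x a (h c) : ℝ)) hd fun c => by fun_prop

/-- The vectors `u_t`, `v_t` and the draw are independent, so the mean factors, and the second
factor does not depend on the row. This is what makes rows comparable. -/
theorem integral_reward_random_col (t k : ℕ) (i : Fin K) (h : Fin L → Fin L) :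
    ∫ ω, reward ω t i (h (ω.2.2.1 k)) ∂law PU PV = mean PU i * avgMean PV h := by
  have hm : Measurable fun p : (Fin L → unitInterval) × Fin L × Fin K => (p.1 (h p.2.1) : ℝ) :=
    measurable_apply_countable_param (by fun_prop) (by fun_prop) h
  have hint : Integrable (fun p : (Fin L → unitInterval) × Fin L × Fin K => (p.1 (h p.2.1) : ℝ))
      (PV.prod ((uniform L).prod (uniform K))) :=
    Integrable.of_mem_Icc 0 1 hm.aemeasurable
      (Filter.Eventually.of_forall fun p => (p.1 (h p.2.1)).2)
  have hm' : Measurable fun p : (Fin K → unitInterval) × (Fin L → unitInterval) × Fin L × Fin K =>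
      (p.1 i : ℝ) * (p.2.1 (h p.2.2.1) : ℝ) :=
    Measurable.mul (by fun_prop) (hm.comp measurable_snd)
  have hmp := measurePreserving_coords PU PV t k
  calc _ = ∫ p, (p.1 i : ℝ) * (p.2.1 (h p.2.2.1) : ℝ)
        ∂(PU.prod (PV.prod ((uniform L).prod (uniform K)))) := by
        rw [← hmp.map_eq, integral_map hmp.measurable.aemeasurable hm'.aestronglyMeasurable]
        rfl
    _ = _ := by
        rw [integral_prod_mul (fun u : Fin K → unitInterval => (u i : ℝ))
          (fun p : (Fin L → unitInterval) × Fin L × Fin K => (p.1 (h p.2.1) : ℝ)),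
          integral_prod_symm _ hint]
        congr 1
        change ∫ y : Fin L × Fin K, mean PV (h y.1) ∂_ = _
        rw [integral_fun_fst (fun c => mean PV (h c)), integral_uniform]
        simp [avgMean]

theorem integral_reward_random_row (t k : ℕ) (j : Fin L) (h : Fin K → Fin K) :
    ∫ ω, reward ω t (h (ω.2.2.2 k)) j ∂law PU PV = mean PV j * avgMean PU h := by
  have hm' : Measurable fun p : (Fin K → unitInterval) × (Fin L → unitInterval) × Fin L × Fin K =>
      (p.1 (h p.2.2.2) : ℝ) * (p.2.1 j : ℝ) :=
    Measurable.mul (measurable_apply_countable_param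
      (d := fun p : (Fin K → unitInterval) × (Fin L → unitInterval) × Fin L × Fin K => p.2.2.2)
      (by fun_prop) (by fun_prop) h) (by fun_prop)
  have hint : Integrable (fun p : (Fin K → unitInterval) × (Fin L → unitInterval) × Fin L × Fin K =>
      (p.1 (h p.2.2.2) : ℝ) * (p.2.1 j : ℝ))
      (PU.prod (PV.prod ((uniform L).prod (uniform K)))) :=
    Integrable.of_mem_Icc 0 1 hm'.aemeasurable
      (Filter.Eventually.of_forall fun p => (p.1 (h p.2.2.2) * p.2.1 j).2)
  have hmp := measurePreserving_coords PU PV t k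
  calc _ = ∫ p, (p.1 (h p.2.2.2) : ℝ) * (p.2.1 j : ℝ)
        ∂(PU.prod (PV.prod ((uniform L).prod (uniform K)))) := by
        rw [← hmp.map_eq, integral_map hmp.measurable.aemeasurable hm'.aestronglyMeasurable]
        rfl
    _ = _ := by
        rw [integral_prod_symm _ hint]
        simp only [integral_mul_const]
        change ∫ y : (Fin L → unitInterval) × Fin L × Fin K,
          mean PU (h y.2.2) * (y.1 j : ℝ) ∂_ = _
        simp only [mul_comm (mean PU _)]
        rw [integral_prod_mul (fun v : Fin L → unitInterval => (v j : ℝ))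
          (fun y : Fin L × Fin K => mean PU (h y.2)),
          integral_fun_snd (fun r => mean PU (h r)), integral_uniform]
        simp [avgMean, mean]

theorem integral_reward (t : ℕ) (i : Fin K) (j : Fin L) :
    ∫ ω, reward ω t i j ∂law PU PV = mean PU i * mean PV j := by
  have h := integral_reward_random_col PU PV t 0 i fun _ => j
  rw [h]
  have hL : (L : ℝ) ≠ 0 := Nat.cast_ne_zero.2 (NeZero.ne L)
  simp [avgMean, hL]

theorem meanReward_eq (i : Fin K) (j : Fin L) :
    meanReward PU PV i j = mean PU i * mean PV j :=
  integral_prod_mul (fun u : Fin K → unitInterval => (u i : ℝ))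
    (fun v : Fin L → unitInterval => (v j : ℝ))

theorem reward_mem_Icc (ω : Sample K L) (t : ℕ) (i : Fin K) (j : Fin L) :
    reward ω t i j ∈ Set.Icc (0 : ℝ) 1 :=
  (ω.1 t i * ω.2.1 t j).2

variable (cU : Convention (Fin K)) (cV : Convention (Fin L)) (n : ℕ)

theorem stateAt_spliceSample {k d m : ℕ} {ω : Sample K L}
    (hd : (stateAt cU cV n k ω).log.length ≤ d) (hm : k ≤ m) (ω' : Sample K L) :
    stateAt cU cV n k (spliceSample d m ω ω') = stateAt cU cV n k ω :=
  iterate_congr cU cV n k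
    (fun _ ha => (reward_spliceSample_of_lt m (lt_of_lt_of_le ha hd) ω ω').symm)
    (fun _ ha => (splice_of_lt (lt_of_lt_of_le ha hm) _ _).symm)
    (fun _ ha => (splice_of_lt (lt_of_lt_of_le ha hm) _ _).symm)

/-- The time after `k` explorations. -/
def timeAt (k : ℕ) (ω : Sample K L) : ℕ := (stateAt cU cV n k ω).log.length

theorem measurable_timeAt (k : ℕ) : Measurable (timeAt cU cV n k) :=
  (Measurable.of_discrete (f := List.length)).comp
    (measurable_log.comp (measurable_stateAt cU cV n k))

theorem timeAt_spliceSample (k : ℕ) (ω ω' : Sample K L) :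
    timeAt cU cV n k (spliceSample (timeAt cU cV n k ω) k ω ω') = timeAt cU cV n k ω := by
  rw [timeAt, timeAt, stateAt_spliceSample cU cV n le_rfl le_rfl]

theorem stateAt_spliceSample_timeAt {k k' : ℕ} (h : k' ≤ k) (ω ω' : Sample K L) :
    stateAt cU cV n k' (spliceSample (timeAt cU cV n k ω) k ω ω') = stateAt cU cV n k' ω :=
  stateAt_spliceSample cU cV n (length_log_iterate_mono cU cV n h) h ω'

/-! ### Concentration of the collected rewards -/

/-- The deviation of the rewards collected for row `i` from the sum of their conditional means. -/
def rowDev (i : Fin K) (k : ℕ) (ω : Sample K L) : ℝ :=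
  (stateAt cU cV n k ω).rowSum i - ∑ a ∈ Finset.range k,
    if i ∈ (stateAt cU cV n a ω).I then
      mean PU i * avgMean PV (stateAt cU cV n a ω).hv else 0

/-- The deviation of the rewards collected for column `j` from the sum of their conditional
means. -/
def colDev (j : Fin L) (k : ℕ) (ω : Sample K L) : ℝ :=
  (stateAt cU cV n k ω).colSum j - ∑ a ∈ Finset.range k,
    if j ∈ (stateAt cU cV n a ω).J then
      mean PV j * avgMean PU (stateAt cU cV n a ω).hu else 0

theorem measurable_rowDev (i : Fin K) (k : ℕ) : Measurable (rowDev PU PV cU cV n i k) := by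
  have hS := measurable_stateAt cU cV n
  refine Measurable.sub (Finset.measurable_fun_sum _ fun j _ => ?_)
    (Finset.measurable_fun_sum _ fun a _ => ?_)
  · exact (measurable_pi_apply j).comp ((measurable_pi_apply i).comp (measurable_Cu.comp (hS k)))
  · exact (Measurable.of_discrete (f := fun h : (Fin K → Fin K) × (Fin L → Fin L) =>
      if i ∈ Finset.univ.image h.1 then mean PU i * avgMean PV h.2 else 0)).comp
      ((measurable_hu.comp (hS a)).prodMk (measurable_hv.comp (hS a)))

theorem measurable_colDev (j : Fin L) (k : ℕ) : Measurable (colDev PU PV cU cV n j k) := by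
  have hS := measurable_stateAt cU cV n
  refine Measurable.sub (Finset.measurable_fun_sum _ fun i _ => ?_)
    (Finset.measurable_fun_sum _ fun a _ => ?_)
  · exact (measurable_pi_apply j).comp ((measurable_pi_apply i).comp (measurable_Cv.comp (hS k)))
  · exact (Measurable.of_discrete (f := fun h : (Fin K → Fin K) × (Fin L → Fin L) =>
      if j ∈ Finset.univ.image h.2 then mean PV j * avgMean PU h.1 else 0)).comp
      ((measurable_hu.comp (hS a)).prodMk (measurable_hv.comp (hS a)))

/-- Given the state after `k` explorations, the next play of row `i` uses a time not before `timeAt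
k` and the `k`-th draw, both in the resampled part; the subtracted term is exactly its mean. -/
theorem hasSubgaussianMGF_rowDev (i : Fin K) (k : ℕ) :
    HasSubgaussianMGF (rowDev PU PV cU cV n i k) (k / 4) (law PU PV) := by
  refine hasSubgaussianMGF_of_resampled_increments PU PV (measurable_timeAt cU cV n)
    (timeAt_spliceSample cU cV n) (measurable_rowDev PU PV cU cV n i)
    (fun ω => by simp [rowDev, stateAt, iterate, State.init, State.rowSum])
    (fun k ω => ?_) k
  set s := stateAt cU cV n k ω with hs
  have hstep : ∀ ω', rowDev PU PV cU cV n i (k + 1)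
      (spliceSample (timeAt cU cV n k ω) k ω ω') = rowDev PU PV cU cV n i k ω +
        if i ∈ s.I then reward ω' (s.rowTime cU i) i (s.hv (ω'.2.2.1 k)) -
          mean PU i * avgMean PV s.hv else 0 := by
    intro ω'
    have hstate : ∀ a ∈ Finset.range (k + 1), stateAt cU cV n a
        (spliceSample (timeAt cU cV n k ω) k ω ω') = stateAt cU cV n a ω := fun a ha =>
      stateAt_spliceSample_timeAt cU cV n (Nat.lt_succ_iff.1 (Finset.mem_range.1 ha)) ω ω'
    have hk := hstate k (Finset.self_mem_range_succ k)
    rw [rowDev, Finset.sum_congr rfl fun a ha => by rw [hstate a ha], Finset.sum_range_succ,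
      stateAt, iterate_succ_rowSum]
    change ((stateAt cU cV n k (spliceSample (timeAt cU cV n k ω) k ω ω')).rowSum i +
      if i ∈ (stateAt cU cV n k (spliceSample (timeAt cU cV n k ω) k ω ω')).I then
        reward (spliceSample (timeAt cU cV n k ω) k ω ω')
          ((stateAt cU cV n k (spliceSample (timeAt cU cV n k ω) k ω ω')).rowTime cU i) i
          ((stateAt cU cV n k (spliceSample (timeAt cU cV n k ω) k ω ω')).hv
            (splice k ω.2.2.1 ω'.2.2.1 k)) else 0) - _ = _
    rw [hk, ← hs, splice_of_le le_rfl,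
      reward_spliceSample_of_le k (show timeAt cU cV n k ω ≤ s.rowTime cU i from
        Nat.le_add_right _ _), rowDev, ← hs]
    split_ifs <;> ring
  by_cases hi : i ∈ s.I
  · refine ⟨fun ω' => reward ω' (s.rowTime cU i) i (s.hv (ω'.2.2.1 k)), ?_,
      fun ω' => reward_mem_Icc _ _ _ _, fun ω' => ?_⟩
    · exact Measurable.mul (by fun_prop)
        (measurable_apply_countable_param (d := fun ω' : Sample K L => ω'.2.2.1 k) (by fun_prop)
          (by fun_prop) s.hv)
    · rw [hstep, if_pos hi, integral_reward_random_col]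
  -- An eliminated row is no longer played and its deviation stays constant.
  · exact ⟨fun _ => 0, measurable_const, fun _ => ⟨le_rfl, zero_le_one⟩, fun ω' => by
      rw [hstep, if_neg hi]; simp⟩

theorem hasSubgaussianMGF_colDev (j : Fin L) (k : ℕ) :
    HasSubgaussianMGF (colDev PU PV cU cV n j k) (k / 4) (law PU PV) := by
  refine hasSubgaussianMGF_of_resampled_increments PU PV (measurable_timeAt cU cV n)
    (timeAt_spliceSample cU cV n) (measurable_colDev PU PV cU cV n j)
    (fun ω => by simp [colDev, stateAt, iterate, State.init, State.colSum])
    (fun k ω => ?_) k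
  set s := stateAt cU cV n k ω with hs
  have hstep : ∀ ω', colDev PU PV cU cV n j (k + 1)
      (spliceSample (timeAt cU cV n k ω) k ω ω') = colDev PU PV cU cV n j k ω +
        if j ∈ s.J then reward ω' (s.colTime cU cV j) (s.hu (ω'.2.2.2 k)) j -
          mean PV j * avgMean PU s.hu else 0 := by
    intro ω'
    have hstate : ∀ a ∈ Finset.range (k + 1), stateAt cU cV n a
        (spliceSample (timeAt cU cV n k ω) k ω ω') = stateAt cU cV n a ω := fun a ha =>
      stateAt_spliceSample_timeAt cU cV n (Nat.lt_succ_iff.1 (Finset.mem_range.1 ha)) ω ω'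
    have hk := hstate k (Finset.self_mem_range_succ k)
    rw [colDev, Finset.sum_congr rfl fun a ha => by rw [hstate a ha], Finset.sum_range_succ,
      stateAt, iterate_succ_colSum]
    change ((stateAt cU cV n k (spliceSample (timeAt cU cV n k ω) k ω ω')).colSum j +
      if j ∈ (stateAt cU cV n k (spliceSample (timeAt cU cV n k ω) k ω ω')).J then
        reward (spliceSample (timeAt cU cV n k ω) k ω ω')
          ((stateAt cU cV n k (spliceSample (timeAt cU cV n k ω) k ω ω')).colTime cU cV j)
          ((stateAt cU cV n k (spliceSample (timeAt cU cV n k ω) k ω ω')).hu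
            (splice k ω.2.2.2 ω'.2.2.2 k)) j else 0) - _ = _
    rw [hk, ← hs, splice_of_le le_rfl,
      reward_spliceSample_of_le k (show timeAt cU cV n k ω ≤ s.colTime cU cV j from
        (Nat.le_add_right _ _).trans (Nat.le_add_right _ _)), colDev, ← hs]
    split_ifs <;> ring
  by_cases hj : j ∈ s.J
  · refine ⟨fun ω' => reward ω' (s.colTime cU cV j) (s.hu (ω'.2.2.2 k)) j, ?_,
      fun ω' => reward_mem_Icc _ _ _ _, fun ω' => ?_⟩
    · exact Measurable.mul
        (measurable_apply_countable_param (d := fun ω' : Sample K L => ω'.2.2.2 k) (by fun_prop)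
          (by fun_prop) s.hu) (by fun_prop)
    · rw [hstep, if_pos hj, integral_reward_random_row]
  · exact ⟨fun _ => 0, measurable_const, fun _ => ⟨le_rfl, zero_le_one⟩, fun ω' => by
      rw [hstep, if_neg hj]; simp⟩

variable {n}

theorem measure_abs_ge_le {M : Sample K L → ℝ} (hn : 2 ≤ n) (ℓ : ℕ)
    (h : HasSubgaussianMGF M ((iters n ℓ : ℕ) / 4) (law PU PV)) :
    law PU PV {ω | iters n ℓ * radius n ℓ ≤ |M ω|} ≤ ENNReal.ofReal (2 / (n : ℝ) ^ 2) := by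
  have hN : 0 < (iters n ℓ : ℝ) := by exact_mod_cast (Nat.zero_le _).trans_lt (iters_lt_succ hn ℓ)
  have hn0 : (0 : ℝ) < n := by positivity
  have hlog : 0 ≤ Real.log n := Real.log_nonneg (by exact_mod_cast (by omega : 1 ≤ n))
  have hε : 0 ≤ iters n ℓ * radius n ℓ := mul_nonneg hN.le (Real.sqrt_nonneg _)
  -- With `N = iters n ℓ` and `N * radius ^ 2 = log n`, the exponent is `(N * radius) ^ 2 / (2 * N /
  -- 4) = 2 * log n`.
  have hexp : Real.exp (-(iters n ℓ * radius n ℓ) ^ 2 /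
      (2 * ((((iters n ℓ : ℕ) : NNReal) / 4 : NNReal) : ℝ))) = 1 / (n : ℝ) ^ 2 := by
    have : -(iters n ℓ * radius n ℓ) ^ 2 / (2 * ((((iters n ℓ : ℕ) : NNReal) / 4 : NNReal) : ℝ)) =
        -(Real.log ((n : ℝ) ^ 2)) := by
      rw [mul_pow, radius, Real.sq_sqrt (div_nonneg hlog hN.le), Real.log_pow]
      push_cast
      field_simp
      norm_num
    rw [this, Real.exp_neg, Real.exp_log (by positivity), one_div]
  have h1 := h.measure_ge_le hε
  have h2 := h.neg.measure_ge_le hε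
  rw [hexp] at h1 h2
  rw [← ENNReal.ofReal_toReal (measure_ne_top _ _)]
  refine ENNReal.ofReal_le_ofReal ?_
  change (law PU PV).real _ ≤ _
  have hsub : {ω | iters n ℓ * radius n ℓ ≤ |M ω|} =
      {ω | iters n ℓ * radius n ℓ ≤ M ω} ∪ {ω | iters n ℓ * radius n ℓ ≤ (-M) ω} := by
    ext ω
    simp [le_abs]
  rw [hsub]
  calc _ ≤ _ := measureReal_union_le _ _
    _ ≤ 1 / (n : ℝ) ^ 2 + 1 / (n : ℝ) ^ 2 := add_le_add h1 h2
    _ = _ := by ring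

/-! ### The regret in terms of the gaps of the chosen arms -/

/-- The expected regret of choosing the arm `a`. -/
def armGap (iStar : Fin K) (jStar : Fin L) (a : Fin K × Fin L) : ℝ :=
  mean PU iStar * mean PV jStar - mean PU a.1 * mean PV a.2

variable (n)

/-- The arm chosen at time `t`, as a random variable. -/
def armAt (t : ℕ) (ω : Sample K L) : Fin K × Fin L :=
  arm cU cV n (reward ω) ω.2.2.1 ω.2.2.2 t

variable {n} (iStar : Fin K) (jStar : Fin L)

theorem measurable_instantRegret (hn : 2 ≤ n) (t : ℕ) :
    Measurable fun ω : Sample K L => reward ω t iStar jStar -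
      reward ω t (armAt cU cV n t ω).1 (armAt cU cV n t ω).2 := by
  have hr : ∀ i j, Measurable fun ω : Sample K L => reward ω t i j := fun i j => by
    unfold reward; fun_prop
  exact (hr _ _).sub (measurable_of_countable_param (F := fun a ω => reward ω t a.1 a.2)
    (measurable_arm cU cV n hn t) fun a => hr a.1 a.2)

theorem integrable_instantRegret (hn : 2 ≤ n) (t : ℕ) :
    Integrable (fun ω : Sample K L => reward ω t iStar jStar -
      reward ω t (armAt cU cV n t ω).1 (armAt cU cV n t ω).2) (law PU PV) := by
  refine Integrable.of_mem_Icc (-1) 1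
    (measurable_instantRegret cU cV iStar jStar hn t).aemeasurable
    (Filter.Eventually.of_forall fun ω => ?_)
  have h1 := reward_mem_Icc ω t iStar jStar
  have h2 := reward_mem_Icc ω t (armAt cU cV n t ω).1 (armAt cU cV n t ω).2
  constructor <;> linarith [h1.1, h1.2, h2.1, h2.2]

/-- The arm at time `t` is decided before `u_t` and `v_t` are revealed, so renewing these vectors
leaves it unchanged and averages the rewards to their means. -/
theorem integral_instantRegret (hn : 2 ≤ n) (t : ℕ) :
    ∫ ω, (reward ω t iStar jStar - reward ω t (armAt cU cV n t ω).1 (armAt cU cV n t ω).2)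
      ∂law PU PV = ∫ ω, armGap PU PV iStar jStar (armAt cU cV n t ω) ∂law PU PV := by
  -- All draws of the first `n` stages are kept, so the arm is fixed; this is harmless because the
  -- vectors are independent of the draws.
  have hmp := measurePreserving_spliceSample PU PV t (prevIters n n)
  have hm := measurable_instantRegret (K := K) (L := L) cU cV iStar jStar hn t
  have hint := integrable_instantRegret PU PV cU cV iStar jStar hn t
  have hrew : ∀ i j, Integrable (fun ω : Sample K L => reward ω t i j) (law PU PV) := fun i j =>
    Integrable.of_mem_Icc 0 1 (by unfold reward; fun_prop)
      (Filter.Eventually.of_forall fun ω => reward_mem_Icc ω t i j)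
  have h1 : ∫ p : Sample K L × Sample K L,
      (fun ω => reward ω t iStar jStar - reward ω t (armAt cU cV n t ω).1 (armAt cU cV n t ω).2)
        (spliceSample t (prevIters n n) p.1 p.2) ∂(law PU PV).prod (law PU PV) =
      ∫ ω, (reward ω t iStar jStar - reward ω t (armAt cU cV n t ω).1 (armAt cU cV n t ω).2)
        ∂law PU PV := by
    conv_rhs => rw [← hmp.map_eq]
    exact (integral_map hmp.measurable.aemeasurable hm.aestronglyMeasurable).symm
  rw [← h1]
  refine (integral_prod _ (hmp.integrable_comp_of_integrable hint)).trans ?_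
  refine integral_congr_ae (Filter.Eventually.of_forall fun ω => ?_)
  have harm : ∀ ω', armAt cU cV n t (spliceSample t (prevIters n n) ω ω') = armAt cU cV n t ω :=
    fun ω' => arm_congr cU cV n hn
      (fun a ha => (reward_spliceSample_of_lt _ ha ω ω').symm)
      (fun a ha => (splice_of_lt ha _ _).symm) (fun a ha => (splice_of_lt ha _ _).symm)
  simp only [Function.comp_apply, harm, reward_spliceSample_of_le _ le_rfl]
  rw [integral_sub (hrew _ _) (hrew _ _), integral_reward, integral_reward, armGap]

theorem integrable_cumRegret (hn : 2 ≤ n) :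
    Integrable (cumRegret cU cV n iStar jStar) (law PU PV) :=
  integrable_finsetSum _ fun t _ => integrable_instantRegret PU PV cU cV iStar jStar hn t

theorem integral_cumRegret (hn : 2 ≤ n) :
    ∫ ω, cumRegret cU cV n iStar jStar ω ∂law PU PV =
      ∑ t ∈ Finset.range n, ∫ ω, armGap PU PV iStar jStar (armAt cU cV n t ω) ∂law PU PV := by
  refine (integral_finsetSum _ fun t _ =>
    integrable_instantRegret PU PV cU cV iStar jStar hn t).trans ?_
  exact Finset.sum_congr rfl fun t _ => integral_instantRegret PU PV cU cV iStar jStar hn t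

end Law

/-! ### Numerical facts -/

theorem gapTilde_pos (ℓ : ℕ) : 0 < gapTilde ℓ := by unfold gapTilde; positivity

theorem half_le_log {n : ℕ} (hn : 2 ≤ n) : 1 / 2 ≤ Real.log n := by
  have h1 := Real.log_two_gt_d9
  have h3 : Real.log 2 ≤ Real.log n := Real.log_le_log (by norm_num) (by exact_mod_cast hn)
  linarith

theorem iters_pos {n : ℕ} (hn : 2 ≤ n) (ℓ : ℕ) : 0 < iters n ℓ :=
  (Nat.zero_le _).trans_lt (iters_lt_succ hn ℓ)

theorem radius_le {n : ℕ} (hn : 2 ≤ n) (ℓ : ℕ) : radius n ℓ ≤ gapTilde ℓ / 2 := by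
  have h1 := half_le_log hn
  have h2 : (0 : ℝ) < iters n ℓ := by exact_mod_cast iters_pos hn ℓ
  have hg := gapTilde_pos ℓ
  have h3 : 4 * (gapTilde ℓ ^ 2)⁻¹ * Real.log n ≤ iters n ℓ := Nat.le_ceil _
  refine Real.sqrt_le_iff.2 ⟨by positivity, ?_⟩
  rw [div_le_iff₀ h2]
  calc Real.log n = (gapTilde ℓ / 2) ^ 2 * (4 * (gapTilde ℓ ^ 2)⁻¹ * Real.log n) := by
        field_simp
        norm_num
    _ ≤ _ := by gcongr

/-- Rounding up adds less than `1 ≤ 2 * log n`, which turns the factor `4` into `6`. -/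
theorem iters_le {n : ℕ} (hn : 2 ≤ n) (ℓ : ℕ) : (iters n ℓ : ℝ) ≤ 6 * 4 ^ ℓ * Real.log n := by
  have h1 := half_le_log hn
  have h2 : (gapTilde ℓ ^ 2)⁻¹ = 4 ^ ℓ := by
    rw [gapTilde, ← pow_mul, mul_comm, pow_mul, ← inv_pow]; norm_num
  have h4 : (1 : ℝ) ≤ 4 ^ ℓ := one_le_pow₀ (by norm_num)
  have h3 := Nat.ceil_lt_add_one (a := 4 * (gapTilde ℓ ^ 2)⁻¹ * Real.log n) (by positivity)
  rw [iters]
  rw [h2] at h3 ⊢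
  nlinarith

/-- The bound `2 ^ m` is carried for the induction: when the term `2 ^ m < x` is added, the earlier
terms contribute at most another `2 ^ m`. -/
theorem sum_two_pow_lt_le {x : ℝ} (hx : 0 ≤ x) (m : ℕ) :
    ∑ ℓ ∈ Finset.range m, (if (2 : ℝ) ^ ℓ < x then (2 : ℝ) ^ ℓ else 0) ≤ min (2 ^ m) (2 * x) := by
  induction m with
  | zero => simp [hx]
  | succ m ih =>
    rw [Finset.sum_range_succ]
    obtain ⟨h1, h2⟩ := le_min_iff.1 ih
    split_ifs with h
    · exact le_min (by rw [pow_succ]; linarith) (by linarith)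
    · have : (2 : ℝ) ^ m ≤ 2 ^ (m + 1) := pow_le_pow_right₀ (by norm_num) (by omega)
      exact le_min (by linarith) (by linarith)

/-- A bound on the regret of a row or a column with modified gap `D` in an exploration of
stage `ℓ`. -/
def stageCost (μ : ℝ) (D : ℝ≥0∞) (ℓ : ℕ) : ℝ :=
  open Classical in
  if ENNReal.ofReal μ * D < ENNReal.ofReal (4 * gapTilde ℓ) then 8 * gapTilde ℓ / μ else 0

theorem stageCost_nonneg {μ : ℝ} (hμ : 0 ≤ μ) (D : ℝ≥0∞) (ℓ : ℕ) : 0 ≤ stageCost μ D ℓ := by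
  have := gapTilde_pos ℓ
  unfold stageCost
  split_ifs <;> positivity

theorem ofReal_sum_stageCost_le {n : ℕ} (hn : 2 ≤ n) {μ : ℝ} (hμ : 0 < μ) (D : ℝ≥0∞) (m : ℕ) :
    ENNReal.ofReal (∑ ℓ ∈ Finset.range m, iters n ℓ * stageCost μ D ℓ) ≤
      1 / ENNReal.ofReal μ ^ 2 * (384 / D) * ENNReal.ofReal (Real.log n) := by
  have hlog : 0 < Real.log n := lt_of_lt_of_le (by norm_num) (half_le_log hn)
  have hμ0 : ENNReal.ofReal μ ≠ 0 := by simpa using hμ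
  rcases eq_or_ne D 0 with rfl | hD0
  · have : 1 / ENNReal.ofReal μ ^ 2 * (384 / 0) * ENNReal.ofReal (Real.log n) = ⊤ := by
      rw [ENNReal.div_zero (by norm_num), ENNReal.mul_top (by simp), ENNReal.top_mul]
      simpa using hlog
    rw [this]
    exact le_top
  rcases eq_or_ne D ⊤ with rfl | hD
  -- An infinite modified gap is below no threshold, so nothing is ever charged.
  · simp [stageCost, ENNReal.mul_top hμ0]
  obtain ⟨d, hd, rfl⟩ : ∃ d : ℝ, 0 < d ∧ D = ENNReal.ofReal d :=
    ⟨D.toReal, ENNReal.toReal_pos hD0 hD, (ENNReal.ofReal_toReal hD).symm⟩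
  have hrhs : 1 / ENNReal.ofReal μ ^ 2 * (384 / ENNReal.ofReal d) * ENNReal.ofReal (Real.log n) =
      ENNReal.ofReal (1 / μ ^ 2 * (384 / d) * Real.log n) := by
    rw [ENNReal.ofReal_mul (by positivity), ENNReal.ofReal_mul (by positivity),
      ENNReal.ofReal_div_of_pos (by positivity), ENNReal.ofReal_div_of_pos hd,
      ENNReal.ofReal_pow hμ.le]
    simp
  rw [hrhs]
  refine ENNReal.ofReal_le_ofReal ?_
  calc ∑ ℓ ∈ Finset.range m, iters n ℓ * stageCost μ (ENNReal.ofReal d) ℓ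
      ≤ ∑ ℓ ∈ Finset.range m, 48 * Real.log n / μ *
          (if (2 : ℝ) ^ ℓ < 4 / (μ * d) then (2 : ℝ) ^ ℓ else 0) := by
        refine Finset.sum_le_sum fun ℓ _ => ?_
        have hg := gapTilde_pos ℓ
        have h2 : (2 : ℝ) ^ ℓ * gapTilde ℓ = 1 := by
          rw [gapTilde, ← mul_pow]; norm_num
        have h4 : (4 : ℝ) ^ ℓ = 2 ^ ℓ * 2 ^ ℓ := by rw [← mul_pow]; norm_num
        have hiff : ENNReal.ofReal μ * ENNReal.ofReal d < ENNReal.ofReal (4 * gapTilde ℓ) ↔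
            (2 : ℝ) ^ ℓ < 4 / (μ * d) := by
          rw [← ENNReal.ofReal_mul hμ.le, ENNReal.ofReal_lt_ofReal_iff (by positivity),
            lt_div_iff₀ (by positivity)]
          have hp : (0 : ℝ) < 2 ^ ℓ := by positivity
          constructor
          · intro h
            have := mul_lt_mul_of_pos_left h hp
            nlinarith
          · intro h
            have := mul_lt_mul_of_pos_right h hg
            nlinarith
        rw [stageCost]
        by_cases h : (2 : ℝ) ^ ℓ < 4 / (μ * d)
        · rw [if_pos (hiff.2 h), if_pos h]
          calc (iters n ℓ : ℝ) * (8 * gapTilde ℓ / μ)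
              ≤ 6 * 4 ^ ℓ * Real.log n * (8 * gapTilde ℓ / μ) := by
                gcongr
                exact iters_le hn ℓ
            _ = 48 * Real.log n / μ * 2 ^ ℓ * (2 ^ ℓ * gapTilde ℓ) := by rw [h4]; ring
            _ = _ := by rw [h2, mul_one]
        · rw [if_neg fun hh => h (hiff.1 hh), if_neg h]
          simp
    -- Here `48 = 6 * 8`, and the geometric sum is at most twice its threshold; `48 * 2 * 4 = 384`.
    _ ≤ 48 * Real.log n / μ * (2 * (4 / (μ * d))) := by
        rw [← Finset.mul_sum]
        gcongr
        exact (sum_two_pow_lt_le (by positivity) m).trans (min_le_right _ _)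
    _ = _ := by field_simp; norm_num

/-! ### Elimination on the good event -/

/-- One elimination, for accurate estimates: the best index `star` survives, every index is
represented by one that is at least as good, and the remaining indices are almost optimal. -/
theorem elimination_step {ι : Type*} {m Z : ι → ℝ} {star p : ι} {h : ι → ι} {N w ρ : ℝ}
    (hstar : ∀ i, m i ≤ m star) (hs : h star = star) (hup : ∀ i, m i ≤ m (h i)) (hN : 0 < N)
    (hw : 0 ≤ w) (hZ : ∀ i, |Z (h i) - N * w * m (h i)| < N * ρ) (hp : ∃ a, h a = p)
    (hmax : ∀ i, 1 / N * Z (h i) - ρ ≤ 1 / N * Z p - ρ) {h' : ι → ι}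
    (hh' : ∀ i, h' i = if 1 / N * Z (h i) + ρ ≤ 1 / N * Z p - ρ then p else h i) :
    h' star = star ∧ (∀ i, m i ≤ m (h' i)) ∧ ∀ i, w * (m star - m (h' i)) < 4 * ρ := by
  have hz : ∀ i, w * m (h i) - ρ < 1 / N * Z (h i) ∧ 1 / N * Z (h i) < w * m (h i) + ρ := by
    intro i
    obtain ⟨h1, h2⟩ := abs_lt.1 (hZ i)
    rw [one_div, inv_mul_eq_div, lt_div_iff₀ hN, div_lt_iff₀ hN]
    constructor <;> linarith
  obtain ⟨a, rfl⟩ := hp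
  have hza := hz a
  have hzs := hz star
  have hms := hmax star
  rw [hs] at hzs hms
  have hws : ∀ i, w * m i ≤ w * m star := fun i => mul_le_mul_of_nonneg_left (hstar i) hw
  refine ⟨?_, fun i => ?_, fun i => ?_⟩
  -- The upper bound of `star` exceeds `w * m star`, while the lower bound of `p` stays below `w * m
  -- p`.
  · rw [hh', if_neg, hs]
    rw [hs]
    have := hws (h a)
    linarith
  · rw [hh']
    split_ifs with hc
    · have hzi := hz i
      -- Disjoint confidence intervals certify that the replacement is better.
      have h1 : w * m (h i) < w * m (h a) := by linarith [(abs_nonneg _).trans_lt (hZ i)]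
      exact (hup i).trans (lt_of_mul_lt_mul_left h1 hw).le
    · exact hup i
  -- Each of the two estimates compared, for the index and for `star`, errs by less than `ρ`. The
  -- picked index therefore loses less than `2 * ρ`; a kept one may lose `2 * ρ` more, since its
  -- interval overlaps that of `p`.
  · rw [hh']
    split_ifs with hc
    · have hρ : 0 < ρ := by
        have := (abs_nonneg _).trans_lt (hZ i)
        exact pos_of_mul_pos_right this hN.le
      linarith
    · have hzi := hz i
      linarith

theorem avgReward_le_avgMean_left (PU : Measure (Fin K → unitInterval))
    (PV : Measure (Fin L → unitInterval)) {h : Fin K → Fin K}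
    (hh : ∀ i, mean PU i ≤ mean PU (h i)) : avgReward PU PV ≤ avgMean PU h :=
  (min_le_left _ _).trans
    (mul_le_mul_of_nonneg_left (Finset.sum_le_sum fun i _ => hh i) (by positivity))

theorem avgReward_le_avgMean_right (PU : Measure (Fin K → unitInterval))
    (PV : Measure (Fin L → unitInterval)) {h : Fin L → Fin L}
    (hh : ∀ i, mean PV i ≤ mean PV (h i)) : avgReward PU PV ≤ avgMean PV h :=
  (min_le_right _ _).trans
    (mul_le_mul_of_nonneg_left (Finset.sum_le_sum fun i _ => hh i) (by positivity))

section Good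

variable (PU : Measure (Fin K → unitInterval)) (PV : Measure (Fin L → unitInterval))
  (cU : Convention (Fin K)) (cV : Convention (Fin L)) (n : ℕ)

/-- The estimates at the end of the first `n` stages are accurate. -/
def Good (ω : Sample K L) : Prop :=
  ∀ ℓ < n, (∀ i, |rowDev PU PV cU cV n i (iters n ℓ) ω| < iters n ℓ * radius n ℓ) ∧
    ∀ j, |colDev PU PV cU cV n j (iters n ℓ) ω| < iters n ℓ * radius n ℓ

/-- The optimal row and column remain, and all rows and columns are represented by ones that are
at least as good. -/
structure Sound (iStar : Fin K) (jStar : Fin L) (s : State K L) : Prop where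
  hu_star : s.hu iStar = iStar
  le_hu : ∀ i, mean PU i ≤ mean PU (s.hu i)
  hv_star : s.hv jStar = jStar
  le_hv : ∀ j, mean PV j ≤ mean PV (s.hv j)

variable {PU PV n} {iStar : Fin K} {jStar : Fin L} {ω : Sample K L}

/-- A row still present was played in every exploration, so all remaining rows share the same
accumulated weight. -/
theorem rowDev_eq_of_mem {k : ℕ} {i : Fin K} (hi : i ∈ (stateAt cU cV n k ω).I) :
    rowDev PU PV cU cV n i (k + 1) ω = (stateAt cU cV n (k + 1) ω).rowSum i -
      (∑ a ∈ Finset.range (k + 1), avgMean PV (stateAt cU cV n a ω).hv) * mean PU i := by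
  rw [rowDev, mul_comm, Finset.mul_sum]
  congr 1
  refine Finset.sum_congr rfl fun a ha => if_pos ?_
  exact iterate_I_antitone cU cV n _ _ _ (Nat.lt_succ_iff.1 (Finset.mem_range.1 ha)) hi

theorem colDev_eq_of_mem {k : ℕ} {j : Fin L} (hj : j ∈ (stateAt cU cV n k ω).J) :
    colDev PU PV cU cV n j (k + 1) ω = (stateAt cU cV n (k + 1) ω).colSum j -
      (∑ a ∈ Finset.range (k + 1), avgMean PU (stateAt cU cV n a ω).hu) * mean PV j := by
  rw [colDev, mul_comm, Finset.mul_sum]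
  congr 1
  refine Finset.sum_congr rfl fun a ha => if_pos ?_
  exact iterate_J_antitone cU cV n _ _ _ (Nat.lt_succ_iff.1 (Finset.mem_range.1 ha)) hj

theorem stateAt_succ (k : ℕ) (ω : Sample K L) :
    stateAt cU cV n (k + 1) ω = ((stateAt cU cV n k ω).explore cU cV (reward ω) (ω.2.2.1 k)
      (ω.2.2.2 k)).maybeEliminate cU cV n (k + 1) := rfl

/-- Soundness is required at all earlier explorations, not only in this stage, because the sums are
carried over and the weight averages over the whole past. -/
theorem Sound.of_end_of_stage (hn : 2 ≤ n) (hμ : 0 ≤ avgReward PU PV)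
    (hU : ∀ i, mean PU i ≤ mean PU iStar) (hV : ∀ j, mean PV j ≤ mean PV jStar)
    (hgood : Good PU PV cU cV n ω) {ℓ : ℕ} (hℓ : ℓ < n)
    (hprev : ∀ k < iters n ℓ, Sound PU PV iStar jStar (stateAt cU cV n k ω)) :
    Sound PU PV iStar jStar (stateAt cU cV n (iters n ℓ) ω) ∧
      (∀ i, avgReward PU PV * gap PU iStar ((stateAt cU cV n (iters n ℓ) ω).hu i) <
        4 * radius n ℓ) ∧
      ∀ j, avgReward PU PV * gap PV jStar ((stateAt cU cV n (iters n ℓ) ω).hv j) <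
        4 * radius n ℓ := by
  obtain ⟨hgU, hgV⟩ := hgood ℓ hℓ
  have hNpos := iters_pos hn ℓ
  have hNR : (0 : ℝ) < iters n ℓ := by exact_mod_cast hNpos
  obtain ⟨k, hk⟩ : ∃ k, iters n ℓ = k + 1 := ⟨iters n ℓ - 1, by omega⟩
  have hSk := hprev k (by omega)
  set s := stateAt cU cV n k ω with hs
  set e := s.explore cU cV (reward ω) (ω.2.2.1 k) (ω.2.2.2 k) with he
  have hend : stateAt cU cV n (iters n ℓ) ω = e.eliminate cU cV n ℓ := by
    rw [hk, stateAt_succ, ← hk, maybeEliminate_iters cU cV hn]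
  have heu : e.hu = s.hu := explore_hu _ _ _ _ _ _
  have hev : e.hv = s.hv := explore_hv _ _ _ _ _ _
  have heI : e.I = s.I := by rw [State.I, heu]; rfl
  have heJ : e.J = s.J := by rw [State.J, hev]; rfl
  have hmemI : ∀ i, s.hu i ∈ s.I := fun i => Finset.mem_image_of_mem _ (Finset.mem_univ i)
  have hmemJ : ∀ j, s.hv j ∈ s.J := fun j => Finset.mem_image_of_mem _ (Finset.mem_univ j)
  set wV : ℝ := 1 / iters n ℓ *
    ∑ a ∈ Finset.range (iters n ℓ), avgMean PV (stateAt cU cV n a ω).hv with hwV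
  set wU : ℝ := 1 / iters n ℓ *
    ∑ a ∈ Finset.range (iters n ℓ), avgMean PU (stateAt cU cV n a ω).hu with hwU
  have havg : ∀ f : ℕ → ℝ, (∀ a < iters n ℓ, avgReward PU PV ≤ f a) →
      avgReward PU PV ≤ 1 / iters n ℓ * ∑ a ∈ Finset.range (iters n ℓ), f a := by
    intro f hf
    rw [one_div, inv_mul_eq_div, le_div_iff₀ hNR]
    have := Finset.card_nsmul_le_sum (Finset.range (iters n ℓ)) f _
      fun a ha => hf a (Finset.mem_range.1 ha)
    rw [Finset.card_range, nsmul_eq_mul] at this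
    linarith
  have hμV : avgReward PU PV ≤ wV :=
    havg _ fun a ha => avgReward_le_avgMean_right PU PV (hprev a ha).le_hv
  have hμU : avgReward PU PV ≤ wU :=
    havg _ fun a ha => avgReward_le_avgMean_left PU PV (hprev a ha).le_hu
  have hZU : ∀ i, |e.rowSum (s.hu i) - iters n ℓ * wV * mean PU (s.hu i)| <
      iters n ℓ * radius n ℓ := by
    intro i
    have h := hgU (s.hu i)
    rw [hk, rowDev_eq_of_mem cU cV (hmemI i), ← hk, hend] at h
    have hw : (iters n ℓ : ℝ) * wV =
        ∑ a ∈ Finset.range (iters n ℓ), avgMean PV (stateAt cU cV n a ω).hv := by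
      rw [hwV]; field_simp
    rw [hw]
    exact h
  have hZV : ∀ j, |e.colSum (s.hv j) - iters n ℓ * wU * mean PV (s.hv j)| <
      iters n ℓ * radius n ℓ := by
    intro j
    have h := hgV (s.hv j)
    rw [hk, colDev_eq_of_mem cU cV (hmemJ j), ← hk, hend] at h
    have hw : (iters n ℓ : ℝ) * wU =
        ∑ a ∈ Finset.range (iters n ℓ), avgMean PU (stateAt cU cV n a ω).hu := by
      rw [hwU]; field_simp
    rw [hw]
    exact h
  have hpU := cU.pick_mem e.I (e.lcbU n ℓ) ⟨_, heI ▸ hmemI iStar⟩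
  have hpV := cV.pick_mem e.J (e.lcbV n ℓ) ⟨_, heJ ▸ hmemJ jStar⟩
  obtain ⟨a, -, ha⟩ := Finset.mem_image.1 hpU
  obtain ⟨b, -, hb⟩ := Finset.mem_image.1 hpV
  obtain ⟨u1, u2, u3⟩ := elimination_step (Z := e.rowSum) (h' := (e.eliminate cU cV n ℓ).hu) hU
    hSk.hu_star hSk.le_hu hNR (hμ.trans hμV) hZU ⟨a, heu ▸ ha⟩
    (fun i => cU.le_pick e.I (e.lcbU n ℓ) _ (heI ▸ hmemI i)) (fun i => by rw [← heu]; rfl)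
  obtain ⟨v1, v2, v3⟩ := elimination_step (Z := e.colSum) (h' := (e.eliminate cU cV n ℓ).hv) hV
    hSk.hv_star hSk.le_hv hNR (hμ.trans hμU) hZV ⟨b, hev ▸ hb⟩
    (fun j => cV.le_pick e.J (e.lcbV n ℓ) _ (heJ ▸ hmemJ j)) (fun j => by rw [← hev]; rfl)
  rw [hend]
  refine ⟨⟨u1, u2, v1, v2⟩, fun i => ?_, fun j => ?_⟩
  · exact (mul_le_mul_of_nonneg_right hμV (sub_nonneg.2 (hU _))).trans_lt (u3 i)
  · exact (mul_le_mul_of_nonneg_right hμU (sub_nonneg.2 (hV _))).trans_lt (v3 j)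

theorem stateAt_succ_of_not_exists {k : ℕ} (h : ¬∃ ℓ, iters n ℓ = k + 1) (ω : Sample K L) :
    (stateAt cU cV n (k + 1) ω).hu = (stateAt cU cV n k ω).hu ∧
      (stateAt cU cV n (k + 1) ω).hv = (stateAt cU cV n k ω).hv := by
  rw [stateAt_succ, State.maybeEliminate, dif_neg h]
  exact ⟨explore_hu _ _ _ _ _ _, explore_hv _ _ _ _ _ _⟩

theorem Sound.stateAt (hn : 2 ≤ n) (hμ : 0 ≤ avgReward PU PV)
    (hU : ∀ i, mean PU i ≤ mean PU iStar) (hV : ∀ j, mean PV j ≤ mean PV jStar)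
    (hgood : Good PU PV cU cV n ω) (k : ℕ) (hk : k < prevIters n n + 1) :
    Sound PU PV iStar jStar (stateAt cU cV n k ω) := by
  induction k using Nat.strong_induction_on with
  | _ k ih =>
    cases k with
    | zero => exact ⟨rfl, fun _ => le_rfl, rfl, fun _ => le_rfl⟩
    | succ k =>
      by_cases h : ∃ ℓ, iters n ℓ = k + 1
      · obtain ⟨ℓ, hℓ⟩ := h
        -- `Good` covers only the first `n` stages; the bound on `k` keeps the elimination within
        -- them.
        have hℓn : ℓ < n := by
          obtain ⟨m, rfl⟩ : ∃ m, n = m + 1 := ⟨n - 1, by omega⟩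
          have h1 : iters (m + 1) ℓ ≤ iters (m + 1) m := by
            rw [hℓ]
            exact Nat.lt_succ_iff.1 hk
          exact Nat.lt_succ_iff.2 ((iters_strictMono hn).le_iff_le.1 h1)
        rw [← hℓ]
        refine (Sound.of_end_of_stage cU cV hn hμ hU hV hgood hℓn fun a ha => ih a ?_ ?_).1 <;>
        omega
      · have h1 := ih k (by omega) (by omega)
        obtain ⟨h2, h3⟩ := stateAt_succ_of_not_exists cU cV h ω
        exact ⟨h2 ▸ h1.hu_star, h2 ▸ h1.le_hu, h3 ▸ h1.hv_star, h3 ▸ h1.le_hv⟩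

theorem prevIters_mono (hn : 2 ≤ n) : Monotone (prevIters n) := by
  refine monotone_nat_of_le_succ fun ℓ => ?_
  exact (iters_lt_succ hn ℓ).le

theorem gap_le_one {m : ℕ} (P : Measure (Fin m → unitInterval)) [IsProbabilityMeasure P]
    (i j : Fin m) : gap P i j ≤ 1 := by
  have h1 := mean_nonneg P j
  have h2 := mean_le_one P i
  unfold gap
  linarith

theorem avgReward_le_one [NeZero K] [IsProbabilityMeasure PU] : avgReward PU PV ≤ 1 := by
  refine (min_le_left _ _).trans ?_
  have hK : (0 : ℝ) < K := by exact_mod_cast Nat.pos_of_ne_zero (NeZero.ne K)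
  rw [one_div, inv_mul_eq_div, div_le_one hK]
  have := Finset.sum_le_card_nsmul Finset.univ (mean PU) 1 fun i _ => mean_le_one PU i
  simpa using this

theorem gap_lt_of_mem_stage [NeZero K] [IsProbabilityMeasure PU] [IsProbabilityMeasure PV]
    (hn : 2 ≤ n) (hμ : 0 ≤ avgReward PU PV)
    (hU : ∀ i, mean PU i ≤ mean PU iStar) (hV : ∀ j, mean PV j ≤ mean PV jStar)
    (hgood : Good PU PV cU cV n ω) {ℓ : ℕ} (hℓ : ℓ < n) {k : ℕ} (h1 : prevIters n ℓ ≤ k)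
    (h2 : k < iters n ℓ) :
    (∀ i, avgReward PU PV * gap PU iStar ((stateAt cU cV n k ω).hu i) < 4 * gapTilde ℓ) ∧
      ∀ j, avgReward PU PV * gap PV jStar ((stateAt cU cV n k ω).hv j) < 4 * gapTilde ℓ := by
  induction k, h1 using Nat.le_induction with
  | base =>
    cases ℓ with
    | zero =>
      -- Nothing has been eliminated in stage `0`, but `μ` and the gaps are at most `1 < 4`.
      have h : ∀ x ≤ (1 : ℝ), avgReward PU PV * x < 4 * gapTilde 0 := by
        intro x hx
        have h1 := mul_le_mul_of_nonneg_left hx hμ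
        have h2 : avgReward PU PV ≤ 1 := avgReward_le_one
        simp only [gapTilde, pow_zero]
        linarith
      exact ⟨fun i => h _ (gap_le_one PU _ _), fun j => h _ (gap_le_one PV _ _)⟩
    | succ m =>
      -- The accuracy at the end of stage `m` is at most `gapTilde m / 2 = gapTilde (m + 1)`.
      have hr : 4 * radius n m ≤ 4 * gapTilde (m + 1) := by
        have := radius_le hn m
        have h3 : gapTilde (m + 1) = gapTilde m / 2 := by simp only [gapTilde, pow_succ]; ring
        linarith
      have h := Sound.of_end_of_stage cU cV hn hμ hU hV hgood (ℓ := m) (by omega)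
        fun a ha => Sound.stateAt cU cV hn hμ hU hV hgood a
          (by
            have : iters n m ≤ prevIters n n := prevIters_mono hn (show m + 1 ≤ n by omega)
            omega)
      exact ⟨fun i => (h.2.1 i).trans_le hr, fun j => (h.2.2 j).trans_le hr⟩
  | succ k hk ih =>
    obtain ⟨h3, h4⟩ := stateAt_succ_of_not_exists cU cV
      (iters_ne_of_mem_stage hn (by omega) h2) ω
    rw [h3, h4]
    exact ih (by omega)

/-! ### The regret on the good event -/

/-- If the gap of `i` vanishes, that of `j` is positive, hence at least `minGap`, and the bound for
`j` passes to `i`. -/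
theorem mul_modGap_lt {m m' : ℕ} (P : Measure (Fin m → unitInterval))
    (Q : Measure (Fin m' → unitInterval)) {i₀ i : Fin m} {j₀ j : Fin m'} {μ x : ℝ} (hμ : 0 ≤ μ)
    (hx : 0 < x) (hj : 0 ≤ gap Q j₀ j)
    (hij : ¬(gap P i₀ i = 0 ∧ gap Q j₀ j = 0)) (h1 : μ * gap P i₀ i < x)
    (h2 : μ * gap Q j₀ j < x) :
    ENNReal.ofReal μ * modGap P i₀ (minGap Q j₀) i < ENNReal.ofReal x := by
  have key : ∀ y, μ * y < x → ENNReal.ofReal μ * ENNReal.ofReal y < ENNReal.ofReal x := by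
    intro y hy
    rw [← ENNReal.ofReal_mul hμ]
    exact (ENNReal.ofReal_lt_ofReal_iff hx).2 hy
  by_cases h0 : gap P i₀ i = 0
  · have hj' : 0 < gap Q j₀ j := hj.lt_of_ne fun h => hij ⟨h0, h.symm⟩
    rw [modGap, if_pos h0, h0, ENNReal.ofReal_zero, zero_add]
    exact (mul_le_mul_right (iInf₂_le j hj') _).trans_lt (key _ h2)
  · rw [modGap, if_neg h0, add_zero]
    exact key _ h1

/-- Change one factor at a time; the factor held fixed is at most one. -/
theorem armGap_le [IsProbabilityMeasure PU] [IsProbabilityMeasure PV]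
    (hU : ∀ i, mean PU i ≤ mean PU iStar) (hV : ∀ j, mean PV j ≤ mean PV jStar)
    (a : Fin K × Fin L) :
    armGap PU PV iStar jStar a ≤ gap PU iStar a.1 + gap PV jStar a.2 := by
  have h1 := mean_le_one PV jStar
  have h2 := mean_le_one PU a.1
  have h3 := hU a.1
  have h4 := hV a.2
  unfold armGap gap
  nlinarith

theorem armGap_nonneg (hU : ∀ i, mean PU i ≤ mean PU iStar)
    (hV : ∀ j, mean PV j ≤ mean PV jStar) (a : Fin K × Fin L) :
    0 ≤ armGap PU PV iStar jStar a :=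
  sub_nonneg.2 (mul_le_mul (hU _) (hV _) (mean_nonneg _ _) (mean_nonneg _ _))

theorem armGap_le_one [IsProbabilityMeasure PU] [IsProbabilityMeasure PV] (a : Fin K × Fin L) :
    armGap PU PV iStar jStar a ≤ 1 := by
  have h1 := mul_nonneg (mean_nonneg PU a.1) (mean_nonneg PV a.2)
  have h2 := mul_le_one₀ (mean_le_one PU iStar) (mean_nonneg PV jStar) (mean_le_one PV jStar)
  unfold armGap
  linarith

/-- The regret of an arm can be charged to its row or to its column, so each exploration loop can
charge the indices it runs over. -/
theorem armGap_le_stageCost [IsProbabilityMeasure PU] [IsProbabilityMeasure PV] {μ : ℝ}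
    (hμ : 0 < μ) (hU : ∀ i, mean PU i ≤ mean PU iStar) (hV : ∀ j, mean PV j ≤ mean PV jStar)
    {i : Fin K} {j : Fin L} {ℓ : ℕ} (hi : μ * gap PU iStar i < 4 * gapTilde ℓ)
    (hj : μ * gap PV jStar j < 4 * gapTilde ℓ) :
    armGap PU PV iStar jStar (i, j) ≤ stageCost μ (modGap PU iStar (minGap PV jStar) i) ℓ ∧
      armGap PU PV iStar jStar (i, j) ≤
        stageCost μ (modGap PV jStar (minGap PU iStar) j) ℓ := by
  have hi0 : 0 ≤ gap PU iStar i := sub_nonneg.2 (hU i)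
  have hj0 : 0 ≤ gap PV jStar j := sub_nonneg.2 (hV j)
  have hle := armGap_le hU hV (i, j)
  have hg := gapTilde_pos ℓ
  by_cases hij : gap PU iStar i = 0 ∧ gap PV jStar j = 0
  · have : armGap PU PV iStar jStar (i, j) ≤ 0 := by
      rw [hij.1, hij.2] at hle
      linarith
    exact ⟨this.trans (stageCost_nonneg hμ.le _ _), this.trans (stageCost_nonneg hμ.le _ _)⟩
  · have h8 : armGap PU PV iStar jStar (i, j) ≤ 8 * gapTilde ℓ / μ := by
      rw [le_div_iff₀ hμ]
      nlinarith
    rw [stageCost, stageCost, if_pos (mul_modGap_lt PU PV hμ.le (by positivity) hj0 hij hi hj),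
      if_pos (mul_modGap_lt PV PU hμ.le (by positivity) hi0 (fun h => hij h.symm) hj hi)]
    exact ⟨h8, h8⟩

variable (PU PV iStar jStar) in
/-- A bound on the regret of one exploration in stage `ℓ`. -/
def totalCost (ℓ : ℕ) : ℝ :=
  ∑ i, stageCost (avgReward PU PV) (modGap PU iStar (minGap PV jStar) i) ℓ +
    ∑ j, stageCost (avgReward PU PV) (modGap PV jStar (minGap PU iStar) j) ℓ

theorem totalCost_nonneg (hμ : 0 ≤ avgReward PU PV) (ℓ : ℕ) :
    0 ≤ totalCost PU PV iStar jStar ℓ :=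
  add_nonneg (Finset.sum_nonneg fun _ _ => stageCost_nonneg hμ _ _)
    (Finset.sum_nonneg fun _ _ => stageCost_nonneg hμ _ _)

theorem sum_log_le_in_stage [NeZero K] [IsProbabilityMeasure PU] [IsProbabilityMeasure PV]
    (hn : 2 ≤ n) (hμ : 0 < avgReward PU PV)
    (hU : ∀ i, mean PU i ≤ mean PU iStar) (hV : ∀ j, mean PV j ≤ mean PV jStar)
    (hgood : Good PU PV cU cV n ω) {ℓ : ℕ} (hℓ : ℓ < n) {k : ℕ} (h1 : prevIters n ℓ ≤ k)
    (h2 : k ≤ iters n ℓ) :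
    ((stateAt cU cV n k ω).log.map (armGap PU PV iStar jStar)).sum ≤
      ((stateAt cU cV n (prevIters n ℓ) ω).log.map (armGap PU PV iStar jStar)).sum +
        ((k : ℝ) - prevIters n ℓ) * totalCost PU PV iStar jStar ℓ := by
  induction k, h1 using Nat.le_induction with
  | base => simp
  | succ k hk ih =>
    have hk' := ih (by omega)
    obtain ⟨hi, hj⟩ := gap_lt_of_mem_stage cU cV hn hμ.le hU hV hgood hℓ hk (by omega)
    rw [stateAt_succ, maybeEliminate_log, explore_sum_log]
    set s := stateAt cU cV n k ω
    have hiI : ∀ i ∈ s.I, avgReward PU PV * gap PU iStar i < 4 * gapTilde ℓ := by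
      intro i hiI
      obtain ⟨a, -, rfl⟩ := Finset.mem_image.1 hiI
      exact hi a
    have hjJ : ∀ j ∈ s.J, avgReward PU PV * gap PV jStar j < 4 * gapTilde ℓ := by
      intro j hjJ
      obtain ⟨a, -, rfl⟩ := Finset.mem_image.1 hjJ
      exact hj a
    have hrow : ∑ i ∈ s.I, armGap PU PV iStar jStar (i, s.hv (ω.2.2.1 k)) ≤
        ∑ i, stageCost (avgReward PU PV) (modGap PU iStar (minGap PV jStar) i) ℓ :=
      (Finset.sum_le_sum fun i hiI' =>
        (armGap_le_stageCost hμ hU hV (hiI i hiI') (hj _)).1).trans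
        (Finset.sum_le_univ_sum_of_nonneg fun i => stageCost_nonneg hμ.le _ _)
    have hcol : ∑ j ∈ s.J, armGap PU PV iStar jStar (s.hu (ω.2.2.2 k), j) ≤
        ∑ j, stageCost (avgReward PU PV) (modGap PV jStar (minGap PU iStar) j) ℓ :=
      (Finset.sum_le_sum fun j hjJ' =>
        (armGap_le_stageCost hμ hU hV (hi _) (hjJ j hjJ')).2).trans
        (Finset.sum_le_univ_sum_of_nonneg fun j => stageCost_nonneg hμ.le _ _)
    have htot : _ ≤ totalCost PU PV iStar jStar ℓ := add_le_add hrow hcol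
    push_cast
    linarith

theorem sum_log_le [NeZero K] [IsProbabilityMeasure PU] [IsProbabilityMeasure PV]
    (hn : 2 ≤ n) (hμ : 0 < avgReward PU PV)
    (hU : ∀ i, mean PU i ≤ mean PU iStar) (hV : ∀ j, mean PV j ≤ mean PV jStar)
    (hgood : Good PU PV cU cV n ω) (m : ℕ) (hm : m ≤ n) :
    ((stateAt cU cV n (prevIters n m) ω).log.map (armGap PU PV iStar jStar)).sum ≤
      ∑ ℓ ∈ Finset.range m, iters n ℓ * totalCost PU PV iStar jStar ℓ := by
  induction m with
  | zero => simp [prevIters, stateAt, iterate, State.init]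
  | succ m ih =>
    have h1 := sum_log_le_in_stage cU cV hn hμ hU hV hgood (ℓ := m) (by omega)
      (iters_lt_succ hn m).le le_rfl
    -- The stage is billed for `iters n m` explorations instead of `iters n m - prevIters n m`; the
    -- excess is nonnegative.
    have h2 := mul_nonneg (Nat.cast_nonneg (α := ℝ) (prevIters n m))
      (totalCost_nonneg (PU := PU) (PV := PV) (iStar := iStar) (jStar := jStar) hμ.le m)
    have h3 := ih (by omega)
    rw [Finset.sum_range_succ]
    change ((stateAt cU cV n (iters n m) ω).log.map _).sum ≤ _
    linarith

/-- The log of `n` stages may be longer than `n`; the surplus plays only increase the sum. -/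
theorem sum_getD_le {α : Type*} (g : α → ℝ) (hg : ∀ a, 0 ≤ g a) (d : α) (l : List α) (m : ℕ)
    (hm : m ≤ l.length) : ∑ t ∈ Finset.range m, g (l.getD t d) ≤ (l.map g).sum := by
  induction l generalizing m with
  | nil =>
    obtain rfl : m = 0 := by simpa using hm
    simp
  | cons a l ih =>
    cases m with
    | zero =>
      simp only [Finset.range_zero, Finset.sum_empty]
      exact List.sum_nonneg (by simpa using ⟨hg a, fun b _ => hg b⟩)
    | succ m =>
      rw [Finset.sum_range_succ', List.map_cons, List.sum_cons, add_comm]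
      simpa using ih m (by simpa using hm)

theorem sum_armGap_le_of_good [NeZero K] [NeZero L] [IsProbabilityMeasure PU]
    [IsProbabilityMeasure PV] (hn : 2 ≤ n) (hμ : 0 < avgReward PU PV)
    (hU : ∀ i, mean PU i ≤ mean PU iStar) (hV : ∀ j, mean PV j ≤ mean PV jStar)
    (hgood : Good PU PV cU cV n ω) :
    ∑ t ∈ Finset.range n, armGap PU PV iStar jStar (armAt cU cV n t ω) ≤
      ∑ ℓ ∈ Finset.range n, iters n ℓ * totalCost PU PV iStar jStar ℓ := by
  refine (sum_getD_le (armGap PU PV iStar jStar) (armGap_nonneg hU hV) (0, 0) _ n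
    (le_length_log cU cV hn (reward ω) ω.2.2.1 ω.2.2.2 n)).trans ?_
  rw [run_eq_iterate cU cV _ _ _ hn]
  exact sum_log_le cU cV hn hμ hU hV hgood n le_rfl

end Good

/-! ### The regret bound -/

section Bound

variable [NeZero K] [NeZero L] {PU : Measure (Fin K → unitInterval)} [IsProbabilityMeasure PU]
  {PV : Measure (Fin L → unitInterval)} [IsProbabilityMeasure PV]
  (cU : Convention (Fin K)) (cV : Convention (Fin L)) {n : ℕ} {iStar : Fin K} {jStar : Fin L}

theorem measure_not_good_le (hn : 2 ≤ n) :
    law PU PV {ω | ¬Good PU PV cU cV n ω} ≤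
      n * ((K + L) * ENNReal.ofReal (2 / (n : ℝ) ^ 2)) := by
  have hsub : {ω | ¬Good PU PV cU cV n ω} ⊆ ⋃ ℓ ∈ Finset.range n,
      ((⋃ i ∈ (Finset.univ : Finset (Fin K)),
          {ω | iters n ℓ * radius n ℓ ≤ |rowDev PU PV cU cV n i (iters n ℓ) ω|}) ∪
        ⋃ j ∈ (Finset.univ : Finset (Fin L)),
          {ω | iters n ℓ * radius n ℓ ≤ |colDev PU PV cU cV n j (iters n ℓ) ω|}) := by
    intro ω hω
    by_contra h
    refine hω fun ℓ hℓ => ?_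
    simp only [Set.mem_iUnion, Finset.mem_range, Finset.mem_univ, Set.mem_union, not_exists,
      not_or, exists_const, Set.mem_ofPred_eq, not_le] at h
    exact h ℓ hℓ
  refine (measure_mono hsub).trans ((measure_biUnion_finset_le _ _).trans ?_)
  calc _ ≤ ∑ _ℓ ∈ Finset.range n, ((K + L) * ENNReal.ofReal (2 / (n : ℝ) ^ 2)) := by
        refine Finset.sum_le_sum fun ℓ _ => (measure_union_le _ _).trans ?_
        rw [add_mul]
        refine add_le_add ((measure_biUnion_finset_le _ _).trans ?_)
          ((measure_biUnion_finset_le _ _).trans ?_)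
        · refine (Finset.sum_le_card_nsmul _ _ _ fun i _ =>
            measure_abs_ge_le PU PV hn ℓ (hasSubgaussianMGF_rowDev PU PV cU cV n i _)).trans ?_
          simp
        · refine (Finset.sum_le_card_nsmul _ _ _ fun j _ =>
            measure_abs_ge_le PU PV hn ℓ (hasSubgaussianMGF_colDev PU PV cU cV n j _)).trans ?_
          simp
    _ = _ := by simp

theorem mul_measure_not_good_le (hn : 2 ≤ n) :
    n * law PU PV {ω | ¬Good PU PV cU cV n ω} ≤ 3 * ((K : ℝ≥0∞) + (L : ℝ≥0∞)) := by
  have hn0 : (0 : ℝ) < n := by positivity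
  have h2 : (n : ℝ≥0∞) * (n * ENNReal.ofReal (2 / (n : ℝ) ^ 2)) = 2 := by
    rw [← ENNReal.ofReal_natCast n, ← ENNReal.ofReal_mul hn0.le, ← ENNReal.ofReal_mul hn0.le,
      show (n : ℝ) * (n * (2 / (n : ℝ) ^ 2)) = 2 by field_simp]
    simp
  calc _ ≤ (n : ℝ≥0∞) * (n * ((K + L) * ENNReal.ofReal (2 / (n : ℝ) ^ 2))) :=
        mul_le_mul_right (measure_not_good_le cU cV hn) _
    _ = n * (n * ENNReal.ofReal (2 / (n : ℝ) ^ 2)) * (K + L) := by ring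
    -- The union bound gives the constant `2`, which is relaxed to `3`.
    _ ≤ _ := by
        rw [h2]
        gcongr
        norm_num

theorem ofReal_sum_totalCost_le (hn : 2 ≤ n) (hμ : 0 < avgReward PU PV) :
    ENNReal.ofReal (∑ ℓ ∈ Finset.range n, iters n ℓ * totalCost PU PV iStar jStar ℓ) ≤
      1 / ENNReal.ofReal (avgReward PU PV) ^ 2 *
        (∑ i, 384 / modGap PU iStar (minGap PV jStar) i +
          ∑ j, 384 / modGap PV jStar (minGap PU iStar) j) * ENNReal.ofReal (Real.log n) := by
  have hnn : ∀ D, 0 ≤ ∑ ℓ ∈ Finset.range n, (iters n ℓ : ℝ) * stageCost (avgReward PU PV) D ℓ :=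
    fun D => Finset.sum_nonneg fun ℓ _ =>
      mul_nonneg (Nat.cast_nonneg _) (stageCost_nonneg hμ.le _ _)
  have hsplit : ∑ ℓ ∈ Finset.range n, (iters n ℓ : ℝ) * totalCost PU PV iStar jStar ℓ =
      (∑ i, ∑ ℓ ∈ Finset.range n, iters n ℓ *
        stageCost (avgReward PU PV) (modGap PU iStar (minGap PV jStar) i) ℓ) +
      ∑ j, ∑ ℓ ∈ Finset.range n, iters n ℓ *
        stageCost (avgReward PU PV) (modGap PV jStar (minGap PU iStar) j) ℓ := by
    simp only [totalCost, mul_add, Finset.sum_add_distrib, Finset.mul_sum]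
    congr 1 <;> exact Finset.sum_comm
  rw [hsplit, ENNReal.ofReal_add (Finset.sum_nonneg fun _ _ => hnn _)
    (Finset.sum_nonneg fun _ _ => hnn _), ENNReal.ofReal_sum_of_nonneg fun _ _ => hnn _,
    ENNReal.ofReal_sum_of_nonneg fun _ _ => hnn _, mul_add, add_mul, Finset.mul_sum,
    Finset.mul_sum, Finset.sum_mul, Finset.sum_mul]
  exact add_le_add (Finset.sum_le_sum fun i _ => ofReal_sum_stageCost_le hn hμ _ n)
    (Finset.sum_le_sum fun j _ => ofReal_sum_stageCost_le hn hμ _ n)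

/-- Off the good event each of the `n` arms has expected regret at most one. -/
theorem ofReal_integral_cumRegret_le (hn : 2 ≤ n) (hμ : 0 < avgReward PU PV)
    (hU : ∀ i, mean PU i ≤ mean PU iStar) (hV : ∀ j, mean PV j ≤ mean PV jStar) :
    ENNReal.ofReal (∫ ω, cumRegret cU cV n iStar jStar ω ∂law PU PV) ≤
      ENNReal.ofReal (∑ ℓ ∈ Finset.range n, iters n ℓ * totalCost PU PV iStar jStar ℓ) +
        n * law PU PV {ω | ¬Good PU PV cU cV n ω} := by
  have hm : ∀ t, Measurable fun ω => armGap PU PV iStar jStar (armAt cU cV n t ω) := fun t =>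
    (Measurable.of_discrete (f := armGap PU PV iStar jStar)).comp (measurable_arm cU cV n hn t)
  have hint : ∀ t, Integrable (fun ω => armGap PU PV iStar jStar (armAt cU cV n t ω))
      (law PU PV) := fun t =>
    Integrable.of_mem_Icc 0 1 (hm t).aemeasurable (Filter.Eventually.of_forall fun ω =>
      ⟨armGap_nonneg hU hV _, armGap_le_one _⟩)
  rw [integral_cumRegret PU PV cU cV iStar jStar hn, ← integral_finsetSum _ fun t _ => hint t,
    ofReal_integral_eq_lintegral_ofReal (integrable_finsetSum _ fun t _ => hint t)
      (Filter.Eventually.of_forall fun ω => Finset.sum_nonneg fun t _ => armGap_nonneg hU hV _)]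
  calc _ ≤ ∫⁻ ω, (ENNReal.ofReal
          (∑ ℓ ∈ Finset.range n, iters n ℓ * totalCost PU PV iStar jStar ℓ) +
          {ω | ¬Good PU PV cU cV n ω}.indicator (fun _ => (n : ℝ≥0∞)) ω) ∂law PU PV := by
        refine lintegral_mono fun ω => ?_
        by_cases hg : Good PU PV cU cV n ω
        · exact (ENNReal.ofReal_le_ofReal (sum_armGap_le_of_good cU cV hn hμ hU hV hg)).trans
            le_self_add
        · rw [Set.indicator_of_mem (show ω ∈ {ω | ¬Good PU PV cU cV n ω} from hg)]
          refine le_trans ?_ le_add_self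
          rw [← ENNReal.ofReal_natCast]
          refine ENNReal.ofReal_le_ofReal ?_
          refine (Finset.sum_le_card_nsmul _ _ 1 fun t _ => armGap_le_one _).trans ?_
          simp
    _ ≤ _ := by
        rw [lintegral_add_left measurable_const, lintegral_const, measure_univ, mul_one]
        gcongr
        exact lintegral_indicator_const_le _ _

theorem avgReward_nonneg : 0 ≤ avgReward PU PV :=
  le_min (mul_nonneg (by positivity) (Finset.sum_nonneg fun i _ => mean_nonneg PU i))
    (mul_nonneg (by positivity) (Finset.sum_nonneg fun j _ => mean_nonneg PV j))

theorem exists_mean_pos {m : ℕ} {P : Measure (Fin m → unitInterval)}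
    (h : 0 < 1 / (m : ℝ) * ∑ i, mean P i) : ∃ i, 0 < mean P i := by
  by_contra! hall
  have h1 : 1 / (m : ℝ) * ∑ i, mean P i ≤ 0 :=
    mul_nonpos_of_nonneg_of_nonpos (by positivity) (Finset.sum_nonpos fun i _ => hall i)
  linarith

theorem mean_eq_zero_of_average_eq_zero {m : ℕ} [NeZero m] {P : Measure (Fin m → unitInterval)}
    (h : 1 / (m : ℝ) * ∑ i, mean P i = 0) (i : Fin m) : mean P i = 0 := by
  have hm : (m : ℝ) ≠ 0 := Nat.cast_ne_zero.2 (NeZero.ne m)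
  have h1 : ∑ i, mean P i = 0 := by simpa [hm] using h
  exact (Finset.sum_eq_zero_iff_of_nonneg fun i _ => mean_nonneg P i).1 h1 i (Finset.mem_univ i)

/-- Optimality concerns products only. A positive `μ` makes the optimal product positive, so either
factor can be cancelled. -/
theorem mean_le_of_optimal (hμ : 0 < avgReward PU PV)
    (hopt : ∀ i j, meanReward PU PV i j ≤ meanReward PU PV iStar jStar) :
    (∀ i, mean PU i ≤ mean PU iStar) ∧ ∀ j, mean PV j ≤ mean PV jStar := by
  simp only [meanReward_eq] at hopt
  obtain ⟨a, ha⟩ := exists_mean_pos (hμ.trans_le (min_le_left _ _))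
  obtain ⟨b, hb⟩ := exists_mean_pos (hμ.trans_le (min_le_right _ _))
  have hpos : 0 < mean PU iStar * mean PV jStar := (mul_pos ha hb).trans_le (hopt a b)
  have hi : 0 < mean PU iStar := pos_of_mul_pos_left hpos (mean_nonneg _ _)
  have hj : 0 < mean PV jStar := pos_of_mul_pos_right hpos (mean_nonneg _ _)
  exact ⟨fun i => le_of_mul_le_mul_right (hopt i jStar) hj,
    fun j => le_of_mul_le_mul_left (hopt iStar j) hi⟩

/-- If one average vanishes, so do all means on that side, and no arm has positive mean reward. -/
theorem integral_cumRegret_nonpos_of_avgReward_eq_zero (hn : 2 ≤ n) (hμ : avgReward PU PV = 0) :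
    ∫ ω, cumRegret cU cV n iStar jStar ω ∂law PU PV ≤ 0 := by
  have hzero : mean PU iStar * mean PV jStar = 0 := by
    rcases min_choice (1 / (K : ℝ) * ∑ i, mean PU i) (1 / (L : ℝ) * ∑ j, mean PV j) with h | h
    · rw [mean_eq_zero_of_average_eq_zero (h.symm.trans hμ) iStar, zero_mul]
    · rw [mean_eq_zero_of_average_eq_zero (h.symm.trans hμ) jStar, mul_zero]
  rw [integral_cumRegret PU PV cU cV iStar jStar hn]
  refine Finset.sum_nonpos fun t _ => integral_nonpos fun ω => ?_
  have := mul_nonneg (mean_nonneg PU (armAt cU cV n t ω).1) (mean_nonneg PV (armAt cU cV n t ω).2)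
  simp only [armGap, hzero, Pi.zero_apply]
  linarith

end Bound

end Rank1

end

theorem theorem1 (K L : ℕ) [NeZero K] [NeZero L] (n : ℕ) (hn : 2 ≤ n)
    (PU : MeasureTheory.Measure (Fin K → unitInterval)) [MeasureTheory.IsProbabilityMeasure PU]
    (PV : MeasureTheory.Measure (Fin L → unitInterval)) [MeasureTheory.IsProbabilityMeasure PV]
    (cU : Rank1.Convention (Fin K)) (cV : Rank1.Convention (Fin L))
    (iStar : Fin K) (jStar : Fin L)
    (hopt : ∀ i j, Rank1.meanReward PU PV i j ≤ Rank1.meanReward PU PV iStar jStar) :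
    MeasureTheory.Integrable (Rank1.cumRegret cU cV n iStar jStar) (Rank1.law PU PV) ∧
      ENNReal.ofReal (∫ ω, Rank1.cumRegret cU cV n iStar jStar ω ∂(Rank1.law PU PV)) ≤
        1 / ENNReal.ofReal (Rank1.avgReward PU PV) ^ 2 *
            (∑ i, 384 / Rank1.modGap PU iStar (Rank1.minGap PV jStar) i +
              ∑ j, 384 / Rank1.modGap PV jStar (Rank1.minGap PU iStar) j) *
            ENNReal.ofReal (Real.log n) +
          3 * ((K : ℝ≥0∞) + (L : ℝ≥0∞)) := by
  refine ⟨Rank1.integrable_cumRegret PU PV cU cV iStar jStar hn, ?_⟩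
  rcases (Rank1.avgReward_nonneg (PU := PU) (PV := PV)).eq_or_lt with hμ | hμ
  · rw [ENNReal.ofReal_of_nonpos
      (Rank1.integral_cumRegret_nonpos_of_avgReward_eq_zero cU cV hn hμ.symm)]
    exact zero_le
  · obtain ⟨hU, hV⟩ := Rank1.mean_le_of_optimal hμ hopt
    exact (Rank1.ofReal_integral_cumRegret_le cU cV hn hμ hU hV).trans
      (add_le_add (Rank1.ofReal_sum_totalCost_le hn hμ) (Rank1.mul_measure_not_good_le cU cV hn))
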